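/- All Hilbert spaces are finite dimensional and complex, and bipartite systems are shared by Alice and Bob. A state is a density matrix. A state on $\mathbb{C}^m\otimes\mathbb{C}^n$ is separable if it is a convex combination of product states $\alpha\otimes\beta$, and entangled otherwise; $\mathcal{S}$ denotes the set of separable states. An LOCC map is a trace preserving map implemented by finitely many rounds of local measurements and classical communication. Let $d\ge 2$, let $|\phi_d\rangle=\frac1{\sqrt d}\sum_{k=1}^d|k,k\rangle$ and $\phi_d=|\phi_d\rangle\langle\phi_d|$, and put $f_{class}=\frac{2}{d+1}$. For a bipartite state $\rho$ and an LOCC map $\Omega$ which takes a state $|\psi\rangle\in\mathbb{C}^d$ held by Alice, together with $\rho$, to a $d$-dimensional system held by Bob, let $$f_d(\rho,\Omega)=\int d\psi\,\langle\psi|\Omega(|\psi\rangle\langle\psi|\otimes\rho)|\psi\rangle ,$$ where the integral is over the unitarily invariant (Haar) probability measure on the pure states of $\mathbb{C}^d$. Let $\mathcal{M}$ be the set of bipartite states $\rho$ (of any finite local dimensions) with $f_d(\rho,\Omega)\le f_{class}$ for every such $\Omega$. For an LOCC map $\Lambda$ whose outputs are states on $\mathbb{C}^d\otimes\mathbb{C}^d$,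 let $F_d(\rho,\Lambda)=\mathrm{tr}[\Lambda(\rho)\phi_d]$ and let $f_d(\rho,\Lambda)$ be the average fidelity (with respect to the same measure) of the protocol that applies $\Lambda$ to $\rho$, twirls the output into the isotropic state $F\phi_d+\frac{1-F}{d^2-1}(\mathbb{I}-\phi_d)$ with $F=F_d(\rho,\Lambda)$, and uses this state for standard teleportation; that is, $f_d(\rho,\Lambda)=\frac{F_d(\rho,\Lambda)\,d+1}{d+1}$. For a state $\sigma$ on $\mathbb{C}^m\otimes\mathbb{C}^n$, the activation capacity is $$E_d(\sigma)=\sup_{\Lambda}\ \sup_{\rho\in\mathcal{M}}\frac{f_d(\rho\otimes\sigma,\Lambda)-f_{class}}{G_d(\rho,\Lambda)},\qquad G_d(\rho,\Lambda)=\max_{\pi\in\mathcal{S}}\bigl(f_{class}-f_d(\rho\otimes\pi,\Lambda)\bigr),$$ where $\pi$ ranges over the separable states on $\mathbb{C}^m\otimes\mathbb{C}^n$, and the supremum is over all LOCC maps $\Lambda$ from the joint system of $\rho$ and $\sigma$ to $\mathbb{C}^d\otimes\mathbb{C}^d$ and all $\rho\in\mathcal{M}$ such that $G_d(\rho,\Lambda)\neq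 0$. The robustness of entanglement is $R(\sigma)=\min_{\pi\in\mathcal{S}}R(\sigma\|\pi)$, where $R(\sigma\|\pi)$ is the smallest $s\ge 0$ such that $\frac{1}{1+s}\sigma+\frac{s}{1+s}\pi$ is separable ($+\infty$ if there is none). **Theorem 1.** For every bipartite entangled state $\sigma$ on $\mathbb{C}^m\otimes\mathbb{C}^n$ and every integer $d\ge 2$, $$E_d(\sigma)=R(\sigma).$$ -/

import Mathlib

open scoped Matrix Kronecker ComplexOrder

noncomputable section

namespace Activation

/-- Operators on the Hilbert space `ℂ^A` with orthonormal basis indexed by `A`. A bipartite operator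
of Alice and Bob is an element of `Op (A × B)`: Alice holds the first factor, Bob the second. -/
abbrev Op (A : Type) : Type := Matrix A A ℂ

/-! ### States, separability, robustness of entanglement -/

/-- Density matrices. -/
def IsState {A : Type} [Fintype A] (ρ : Op A) : Prop :=
  ρ.PosSemidef ∧ ρ.trace = 1

/-- The set `𝒮` of separable states on `ℂ^A ⊗ ℂ^B`: mixtures of product states. -/
def Sep (A B : Type) [Fintype A] [Fintype B] : Set (Op (A × B)) :=
  convexHull ℝ {τ | ∃ (α : Op A) (β : Op B), IsState α ∧ IsState β ∧ τ = α ⊗ₖ β}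

/-- `R(σ‖π)`: the smallest `s ≥ 0` such that `σ/(1+s) + s π/(1+s)` is separable
(`⊤` if there is none). -/
def relRobustness {A B : Type} [Fintype A] [Fintype B] (σ π : Op (A × B)) : EReal :=
  ⨅ (s : ℝ) (_ : 0 ≤ s) (_ : (1 / (1 + s)) • σ + (s / (1 + s)) • π ∈ Sep A B), (s : EReal)

/-- The robustness of entanglement `R(σ)`, the minimum of `R(σ‖π)` over separable `π`. -/
def robustness {A B : Type} [Fintype A] [Fintype B] (σ : Op (A × B)) : EReal :=
  ⨅ π ∈ Sep A B, relRobustness σ π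

/-! ### LOCC maps -/

/-- Trace preserving LOCC maps from `ℂ^A ⊗ ℂ^B` to `ℂ^C ⊗ ℂ^D`: finitely many rounds, in each of
which one party performs a measurement given by Kraus operators `K i` (`∑ i, K iᴴ K i = 1`, with an
output space of any finite dimension) and announces the outcome `i`, on which the rest of the
protocol may depend. The resulting map is the sum over all outcomes. -/
inductive IsLOCC {C D : Type} [Fintype C] [DecidableEq C] [Fintype D] [DecidableEq D] :
    ∀ {A B : Type} [Fintype A] [DecidableEq A] [Fintype B] [DecidableEq B],
      (Op (A × B) → Op (C × D)) → Prop
  | done : IsLOCC (fun X : Op (C × D) => X)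
  | alice {A B A' : Type} [Fintype A] [DecidableEq A] [Fintype B] [DecidableEq B]
      [Fintype A'] [DecidableEq A'] {r : ℕ} (K : Fin r → Matrix A' A ℂ)
      (hK : ∑ i, (K i)ᴴ * K i = 1) (Λ : Fin r → Op (A' × B) → Op (C × D))
      (hΛ : ∀ i, IsLOCC (Λ i)) :
      IsLOCC (fun X : Op (A × B) =>
        ∑ i, Λ i ((K i ⊗ₖ (1 : Op B)) * X * (K i ⊗ₖ (1 : Op B))ᴴ))
  | bob {A B B' : Type} [Fintype A] [DecidableEq A] [Fintype B] [DecidableEq B]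
      [Fintype B'] [DecidableEq B'] {r : ℕ} (K : Fin r → Matrix B' B ℂ)
      (hK : ∑ i, (K i)ᴴ * K i = 1) (Λ : Fin r → Op (A × B') → Op (C × D))
      (hΛ : ∀ i, IsLOCC (Λ i)) :
      IsLOCC (fun X : Op (A × B) =>
        ∑ i, Λ i (((1 : Op A) ⊗ₖ K i) * X * ((1 : Op A) ⊗ₖ K i)ᴴ))

/-! ### Teleportation fidelity -/

/-- The pure state `|ψ⟩⟨ψ|`. -/
def pureState {A : Type} (ψ : A → ℂ) : Op A := Matrix.vecMulVec ψ (star ψ)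

/-- The average fidelity `∫ dψ ⟨ψ| N(|ψ⟩⟨ψ|) |ψ⟩` of input and output of a map `N`, for the
normalized unitarily invariant measure on the unit sphere of `ℂ^d`. -/
def avgFidelity (d : ℕ) (N : Op (Fin d) → Op (Fin d)) : ℝ :=
  ⨍ ψ : Metric.sphere (0 : EuclideanSpace ℂ (Fin d)) 1,
    (star (ψ : EuclideanSpace ℂ (Fin d)).ofLp ⬝ᵥ
      (N (pureState (ψ : EuclideanSpace ℂ (Fin d)).ofLp) *ᵥ
        (ψ : EuclideanSpace ℂ (Fin d)).ofLp)).re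
    ∂(MeasureTheory.volume : MeasureTheory.Measure (EuclideanSpace ℂ (Fin d))).toSphere

/-- `f_d(ρ, Ω)` for a general protocol `Ω`: Alice holds the system `ℂ^d` to be teleported
together with her part of the resource `ρ`; at the end Bob holds a system `ℂ^d` and Alice nothing
(a one-dimensional system). -/
def protocolFidelity {A B : Type} (d : ℕ) (ρ : Op (A × B))
    (Ω : Op ((Fin d × A) × B) → Op (Unit × Fin d)) : ℝ :=
  avgFidelity d fun χ =>
    (Ω ((χ ⊗ₖ ρ).submatrix (fun p => (p.1.1, (p.1.2, p.2))) fun p => (p.1.1, (p.1.2, p.2)))).submatrix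
      (fun b => ((), b)) fun b => ((), b)

/-- The vector `|φ_d⟩ = (1/√d) ∑ₖ |k,k⟩`. -/
def maxEntVec (d : ℕ) : Fin d × Fin d → ℂ :=
  fun p => if p.1 = p.2 then ((1 / Real.sqrt d : ℝ) : ℂ) else 0

/-- The projector `φ_d` onto the maximally entangled state. -/
def maxEnt (d : ℕ) : Op (Fin d × Fin d) := pureState (maxEntVec d)

/-- `F_d(ρ, Λ) = tr(Λ(ρ) φ_d)`. -/
def singletFraction {A B : Type} (d : ℕ) (ρ : Op (A × B))
    (Λ : Op (A × B) → Op (Fin d × Fin d)) : ℝ :=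
  (Λ ρ * maxEnt d).trace.re

/-- The `d × d` isotropic state whose fidelity with `φ_d` is `F`. -/
def isotropicState (d : ℕ) (F : ℝ) : Op (Fin d × Fin d) :=
  F • maxEnt d + ((1 - F) / ((d : ℝ) ^ 2 - 1)) • (1 - maxEnt d)

/-- The Weyl (generalized Pauli) unitaries `|b⟩ ↦ ω^(j b) |b + k⟩` on `ℂ^d`, where
`ω = exp(2πi/d)` and `b + k` is taken modulo `d`. -/
def weyl (d : ℕ) (j k : Fin d) : Op (Fin d) :=
  Matrix.of fun a b =>
    if a = b + k then Complex.exp (2 * Real.pi * Complex.I / d) ^ ((j : ℕ) * (b : ℕ)) else 0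

/-- The generalized Bell basis `(U_{jk} ⊗ 1)|φ_d⟩`. -/
def bellVec (d : ℕ) (j k : Fin d) : Fin d × Fin d → ℂ :=
  (weyl d j k ⊗ₖ (1 : Op (Fin d))) *ᵥ maxEntVec d

/-- The standard teleportation protocol with resource `τ` applied to the input `χ`: Alice measures
the input and her half of `τ` in the generalized Bell basis, Bob applies `U_{jk}` to his half. -/
def standardTeleport (d : ℕ) (τ : Op (Fin d × Fin d)) (χ : Op (Fin d)) : Op (Fin d) :=
  ∑ j, ∑ k, weyl d j k *
    (Matrix.of fun b b' => ∑ p : Fin d × Fin d, ∑ q : Fin d × Fin d,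
      star (bellVec d j k p) * (χ p.1 q.1 * τ (p.2, b) (q.2, b')) * bellVec d j k q) *
    (weyl d j k)ᴴ

/-- `f_d(ρ, Λ)` for a map `Λ` into `d × d` operators: the fidelity of the protocol in which `Λ` is
applied to `ρ`, the result is twirled into the isotropic state with the same fidelity with `φ_d`,
and the latter is used for standard teleportation. -/
def teleportFidelity {A B : Type} (d : ℕ) (ρ : Op (A × B))
    (Λ : Op (A × B) → Op (Fin d × Fin d)) : ℝ :=
  avgFidelity d (standardTeleport d (isotropicState d (singletFraction d ρ Λ)))

/-- The classical threshold. -/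
def fClass (d : ℕ) : ℝ := 2 / (d + 1)

/-- The set `ℳ` of states on `ℂ^A ⊗ ℂ^B` that are useless for `d`-dimensional teleportation. -/
def Useless (d : ℕ) (A B : Type) [Fintype A] [DecidableEq A] [Fintype B] [DecidableEq B] :
    Set (Op (A × B)) :=
  {ρ | IsState ρ ∧ ∀ Ω : Op ((Fin d × A) × B) → Op (Unit × Fin d), IsLOCC Ω →
    protocolFidelity d ρ Ω ≤ fClass d}

/-! ### Activation -/

/-- `ρ ⊗ σ`, as a bipartite operator between Alice's two systems and Bob's two systems. -/
def joint {A B A' B' : Type} (ρ : Op (A × B)) (σ : Op (A' × B')) : Op ((A × A') × (B × B')) :=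
  (ρ ⊗ₖ σ).submatrix (Equiv.prodProdProdComm A A' B B') (Equiv.prodProdProdComm A A' B B')

/-- `G_d(ρ, Λ)`: the maximum of `f_class - f_d(ρ ⊗ π, Λ)` over the separable states `π`. -/
def spread {A B A' B' : Type} [Fintype A'] [Fintype B'] (d : ℕ) (ρ : Op (A × B))
    (Λ : Op ((A × A') × (B × B')) → Op (Fin d × Fin d)) : ℝ :=
  sSup {x | ∃ π ∈ Sep A' B', x = fClass d - teleportFidelity d (joint ρ π) Λ}

/-- The activation capacity `E_d(σ)`: the supremum of `(f_d(ρ ⊗ σ, Λ) - f_class) / G_d(ρ, Λ)` over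
all finite-dimensional useless `ρ` and all LOCC maps `Λ` for which the denominator does not
vanish. -/
def activationCapacity {A' B' : Type} [Fintype A'] [DecidableEq A'] [Fintype B'] [DecidableEq B']
    (d : ℕ) (σ : Op (A' × B')) : EReal :=
  sSup {x | ∃ (k l : ℕ) (ρ : Op (Fin k × Fin l))
    (Λ : Op ((Fin k × A') × (Fin l × B')) → Op (Fin d × Fin d)),
    ρ ∈ Useless d (Fin k) (Fin l) ∧ IsLOCC Λ ∧ spread d ρ Λ ≠ 0 ∧
    x = (((teleportFidelity d (joint ρ σ) Λ - fClass d) / spread d ρ Λ : ℝ) : EReal)}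

end Activation

end

/-!
The upper bound `E_d(σ) ≤ R(σ)` (`activationCapacity_le_robustness`): a product state can be
prepared locally, so a useless `ρ` stays useless next to a separable state. Hence the fidelity
deficit `g(π) = f_class - f_d(ρ ⊗ π, Λ)`, which is affine in `π`, is nonnegative on separable `π`.
If `(σ + s π) / (1 + s)` is separable, then `g(σ) + s g(π) ≥ 0`, so that
`-g(σ) ≤ s g(π) ≤ s G_d(ρ, Λ)`.

The lower bound (`robustness_le_activationCapacity`): if `c` is smaller than `R(σ)`, then `σ` is
not in the compact convex set `(1 + c) 𝒮 - c 𝒮`, and a separating hyperplane gives a Hermitian `V`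
that is strictly positive on `𝒮` and satisfies `⟨V, σ⟩ + c ⟨V, π⟩ < 0` for all separable `π`
(`exists_witness`). For large `κ` the operator `κ 1 ⊗ (1 + d φ_d) + V ⊗ (1 - d φ_d)` (`witnessOp`)
is, after normalization, a useless state. If Alice and Bob contract its witness factor with the
second state (`contraction`), the deficit is a positive multiple of `⟨V, π⟩`
(`exists_isLOCC_fClass_sub`). The activation ratio of `σ` is then the quotient of `-⟨V, σ⟩` by the
maximum of `⟨V, π⟩`, which is at least `c`.

The main point is that `witnessOp` is useless (`exists_useless_witnessOp`). As LOCC maps have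
product Kraus operators, it suffices that after each local filtering `K ⊗ L` the overlap with
`1 - d φ_d` is nonnegative (`mem_useless_of_filter`). Partial transposition turns `d φ_d` into the
swap, and the overlap becomes, up to a common factor, a sum (`trace_filter_joint`) in which the
part with `κ` contributes terms `κ ‖q‖²` and the part with `V` contributes terms `⟨e, V^Γ e⟩`.
Here `q` and `e` are obtained from the entries of `K` and `L` by antisymmetrizing one pair of
indices and respectively symmetrizing and antisymmetrizing another. By a Plücker type identity `e`
is a product vector up to terms that contain some `q` (`ptForm_block`). On product vectors the
form of `V^Γ` is strictly positive, which absorbs the cross terms and leaves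
`⟨e, V^Γ e⟩ ≥ -C ∑ ‖q‖²` with a constant `C` (`ptForm_lower_bound`).

Average fidelities are computed from the fourth moments of the uniform distribution on the sphere
(`moment_eq`), which follow from invariance under phases and under rotations of two coordinates.
-/

noncomputable section
namespace Activation

/-! ### Moments of the invariant measure on the unit sphere -/

open MeasureTheory Pointwise in
lemma measurePreserving_toSphere {E : Type*} [NormedAddCommGroup E] [InnerProductSpace ℝ E]
    [MeasurableSpace E] [BorelSpace E] [FiniteDimensional ℝ E] (f : E ≃ₗᵢ[ℝ] E) :
    MeasurePreserving
      (fun x : Metric.sphere (0 : E) 1 => (⟨f x, by simp⟩ : Metric.sphere (0 : E) 1))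
      (volume : Measure E).toSphere (volume : Measure E).toSphere := by
  have hcont : Continuous
      (fun x : Metric.sphere (0 : E) 1 => (⟨f x, by simp⟩ : Metric.sphere (0 : E) 1)) := by
    fun_prop
  refine ⟨hcont.measurable, ?_⟩
  ext s hs
  rw [Measure.map_apply hcont.measurable hs, Measure.toSphere_apply' _ (hcont.measurable hs),
    Measure.toSphere_apply' _ hs]
  congr 1
  rw [← f.measurePreserving.measure_preimage_equiv (f := f.toHomeomorph.toMeasurableEquiv)
    (Set.Ioo (0 : ℝ) 1 • (Subtype.val '' s : Set E))]
  congr 1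
  ext x
  simp only [Set.mem_smul, Set.mem_image, Set.mem_preimage]
  constructor
  · rintro ⟨r, hr, _, ⟨y, hy, rfl⟩, rfl⟩
    exact ⟨r, hr, f y, ⟨_, hy, rfl⟩, by simp⟩
  · rintro ⟨r, hr, _, ⟨y, hy, rfl⟩, h⟩
    refine ⟨r, hr, f.symm y, ⟨⟨f.symm y, by simp⟩, by simpa using hy, rfl⟩, ?_⟩
    apply f.injective
    rw [map_smul, LinearIsometryEquiv.apply_symm_apply]
    exact h

/-- The mean of a function over the unit sphere of `ℂ^d`. -/
def sphereMean (d : ℕ) (g : (Fin d → ℂ) → ℂ) : ℂ :=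
  ⨍ ψ : Metric.sphere (0 : EuclideanSpace ℂ (Fin d)) 1,
    g (ψ : EuclideanSpace ℂ (Fin d)).ofLp
    ∂(MeasureTheory.volume : MeasureTheory.Measure (EuclideanSpace ℂ (Fin d))).toSphere

lemma continuous_sphere_comp {d : ℕ} {F : Type*} [TopologicalSpace F] {g : (Fin d → ℂ) → F}
    (hg : Continuous g) :
    Continuous fun ψ : Metric.sphere (0 : EuclideanSpace ℂ (Fin d)) 1 =>
      g (ψ : EuclideanSpace ℂ (Fin d)).ofLp := by
  fun_prop

lemma integrable_sphere {d : ℕ} {F : Type*} [NormedAddCommGroup F] {g : (Fin d → ℂ) → F}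
    (hg : Continuous g) :
    MeasureTheory.Integrable (fun ψ : Metric.sphere (0 : EuclideanSpace ℂ (Fin d)) 1 =>
      g (ψ : EuclideanSpace ℂ (Fin d)).ofLp)
      (MeasureTheory.volume : MeasureTheory.Measure (EuclideanSpace ℂ (Fin d))).toSphere :=
  (continuous_sphere_comp hg).integrable_of_hasCompactSupport (HasCompactSupport.of_compactSpace _)

/-- The uniform distribution on the sphere is unitarily invariant. -/
lemma sphereMean_mulVec {d : ℕ} (U : Matrix (Fin d) (Fin d) ℂ) (hU : Uᴴ * U = 1)
    {g : (Fin d → ℂ) → ℂ} (hg : Continuous g) :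
    sphereMean d (fun z => g (U *ᵥ z)) = sphereMean d g := by
  let L : EuclideanSpace ℂ (Fin d) →ₗᵢ[ℝ] EuclideanSpace ℂ (Fin d) :=
    { toLinearMap := (Matrix.toEuclideanLin U).restrictScalars ℝ
      norm_map' := fun x => by
        have h : inner ℂ (Matrix.toEuclideanLin U x) (Matrix.toEuclideanLin U x)
            = inner ℂ x x := by
          simp only [EuclideanSpace.inner_eq_star_dotProduct, Matrix.ofLp_toLpLin,
            Matrix.toLin'_apply]
          rw [dotProduct_comm, Matrix.star_mulVec, ← Matrix.dotProduct_mulVec,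
            Matrix.mulVec_mulVec, hU, Matrix.one_mulVec, dotProduct_comm]
        rw [inner_self_eq_norm_sq_to_K, inner_self_eq_norm_sq_to_K] at h
        have h2 : ‖Matrix.toEuclideanLin U x‖ ^ 2 = ‖x‖ ^ 2 := by exact_mod_cast h
        exact (sq_eq_sq₀ (norm_nonneg _) (norm_nonneg _)).1 h2 }
  let f := L.toLinearIsometryEquiv rfl
  have hf : ∀ x : EuclideanSpace ℂ (Fin d), (f x).ofLp = U *ᵥ x.ofLp := fun x => rfl
  have hmp := measurePreserving_toSphere f
  unfold sphereMean
  rw [MeasureTheory.average_eq, MeasureTheory.average_eq]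
  congr 1
  conv_rhs => rw [← hmp.map_eq]
  rw [MeasureTheory.integral_map hmp.aemeasurable
    (continuous_sphere_comp hg).aestronglyMeasurable]
  rfl

lemma sphereMean_add {d : ℕ} {g h : (Fin d → ℂ) → ℂ} (hg : Continuous g) (hh : Continuous h) :
    sphereMean d (fun z => g z + h z) = sphereMean d g + sphereMean d h := by
  simp only [sphereMean, MeasureTheory.average_eq]
  rw [MeasureTheory.integral_add (integrable_sphere hg) (integrable_sphere hh), smul_add]

lemma sphereMean_sum {d : ℕ} {ι : Type*} (s : Finset ι) {g : ι → (Fin d → ℂ) → ℂ}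
    (hg : ∀ i, Continuous (g i)) :
    sphereMean d (fun z => ∑ i ∈ s, g i z) = ∑ i ∈ s, sphereMean d (g i) := by
  simp only [sphereMean, MeasureTheory.average_eq]
  rw [MeasureTheory.integral_finsetSum _ fun i _ => integrable_sphere (hg i), Finset.smul_sum]

lemma sphereMean_const_mul {d : ℕ} (c : ℂ) (g : (Fin d → ℂ) → ℂ) :
    sphereMean d (fun z => c * g z) = c * sphereMean d g := by
  simp only [sphereMean, MeasureTheory.average_eq]
  rw [MeasureTheory.integral_const_mul, mul_smul_comm]

/-- The fourth moments of the uniform distribution on the unit sphere of `ℂ^d`; the last two indices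
belong to conjugated coordinates. -/
def moment (d : ℕ) (i j k l : Fin d) : ℂ :=
  sphereMean d fun z => z i * z j * star (z k) * star (z l)

lemma moment_comm_left {d : ℕ} (i j k l : Fin d) : moment d i j k l = moment d j i k l := by
  unfold moment; congr 1; ext z; ring

lemma moment_comm_right {d : ℕ} (i j k l : Fin d) : moment d i j k l = moment d i j l k := by
  unfold moment; congr 1; ext z; ring

/-- Invariance under the phase change `z t ↦ √-1 z t` of a single coordinate. -/
lemma moment_phase {d : ℕ} (t i j k l : Fin d)
    (h : (if i = t then Complex.I else 1) * (if j = t then Complex.I else 1) *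
      star (if k = t then Complex.I else 1) * star (if l = t then Complex.I else 1) ≠ 1) :
    moment d i j k l = 0 := by
  set u : Fin d → ℂ := fun a => if a = t then Complex.I else 1 with hu
  have hU : (Matrix.diagonal u)ᴴ * Matrix.diagonal u = 1 := by
    rw [Matrix.diagonal_conjTranspose, Matrix.diagonal_mul_diagonal, ← Matrix.diagonal_one]
    congr 1
    ext a
    by_cases ha : a = t <;> simp [hu, ha]
  have key := sphereMean_mulVec (Matrix.diagonal u) hU
    (g := fun z => z i * z j * star (z k) * star (z l)) (by fun_prop)
  have h2 : sphereMean d (fun z => (fun z : Fin d → ℂ => z i * z j * star (z k) * star (z l))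
      (Matrix.diagonal u *ᵥ z)) =
      (u i * u j * star (u k) * star (u l)) * moment d i j k l := by
    unfold moment
    rw [← sphereMean_const_mul]
    congr 1
    ext z
    simp only [Matrix.mulVec_diagonal, star_mul']
    ring
  rw [h2] at key
  change _ = moment d i j k l at key
  by_contra h0
  exact h (mul_right_cancel₀ h0 (key.trans (one_mul _).symm))

lemma moment_eq_zero {d : ℕ} {i j k l : Fin d} (h1 : ¬(i = k ∧ j = l)) (h2 : ¬(i = l ∧ j = k)) :
    moment d i j k l = 0 := by
  have hI1 : Complex.I ≠ 1 := by simp [Complex.ext_iff]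
  have hI2 : (-1 : ℂ) ≠ 1 := by norm_num
  have hI3 : -Complex.I ≠ 1 := by simp [Complex.ext_iff]
  have single : ∀ a b p q : Fin d, p ≠ a → q ≠ a → moment d a b p q = 0 := by
    intro a b p q hp hq
    apply moment_phase a
    by_cases hb : b = a <;> simp [hp, hq, hb, hI1, hI2]
  by_cases hi : k ≠ i ∧ l ≠ i
  · exact single _ _ _ _ hi.1 hi.2
  by_cases hj : k ≠ j ∧ l ≠ j
  · rw [moment_comm_left]; exact single _ _ _ _ hj.1 hj.2
  by_cases hki : k = i
  · subst hki
    have hl : j ≠ l := fun h => h1 ⟨rfl, h⟩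
    have hkj : k = j := by
      by_contra hne
      exact hj ⟨hne, fun h => hl h.symm⟩
    subst hkj
    apply moment_phase l
    simp [hl, hI3]
  · have hli : l = i := by
      by_contra hne
      exact hi ⟨hki, hne⟩
    subst hli
    have hk : j ≠ k := fun h => h2 ⟨rfl, h⟩
    have hlj : l = j := by
      by_contra hne
      exact hj ⟨fun h => hk h.symm, hne⟩
    subst hlj
    apply moment_phase k
    simp [hk, hI3]

/-- Invariance under the rotation `(z i, z j) ↦ (z i + z j, z i - z j) / √2`. -/
lemma moment_hadamard {d : ℕ} {i j : Fin d} (hij : i ≠ j) :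
    4 * moment d i i i i = moment d i i i i + moment d j j j j + 4 * moment d i j i j := by
  set s : ℂ := ((1 / Real.sqrt 2 : ℝ) : ℂ) with hs
  have hss : s * s = 1 / 2 := by
    rw [hs, ← Complex.ofReal_mul, div_mul_div_comm, Real.mul_self_sqrt (by norm_num)]
    norm_num
  have hstar : star s = s := Complex.conj_ofReal _
  have hstar' : (starRingEnd ℂ) s = s := Complex.conj_ofReal _
  let v : Fin d → Fin d → ℂ := fun a =>
    if a = i then Pi.single i s + Pi.single j s
    else if a = j then Pi.single i s - Pi.single j s else Pi.single a 1
  have hv : ∀ a b : Fin d, v a ⬝ᵥ star (v b) = if a = b then 1 else 0 := by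
    intro a b
    by_cases hai : a = i
    · by_cases hbi : b = i
      · simp [v, hai, hbi, hij, hij.symm, dotProduct_add, hstar', hss]; norm_num
      · by_cases hbj : b = j
        · simp [v, hai, hbj, hij, hij.symm, dotProduct_sub, hstar', hss]
        · simp [v, hai, hbi, hbj, Ne.symm hbi]
    · by_cases haj : a = j
      · by_cases hbi : b = i
        · simp [v, haj, hbi, hij, hij.symm, dotProduct_add, hstar', hss]
        · by_cases hbj : b = j
          · simp [v, haj, hbj, hij, hij.symm, dotProduct_sub, hstar', hss]; norm_num
          · simp [v, haj, hbi, hbj, Ne.symm hbj, hij.symm]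
      · by_cases hbi : b = i
        · simp [v, hai, haj, hbi]
        · by_cases hbj : b = j
          · simp [v, hai, haj, hbj, hij.symm]
          · simp [v, hai, haj, hbi, hbj, Pi.single_apply, eq_comm (a := b)]
  have hU : (Matrix.of v)ᴴ * Matrix.of v = 1 := by
    rw [mul_eq_one_comm]
    ext a b
    rw [Matrix.mul_apply, Matrix.one_apply, ← hv a b]
    rfl
  have key := sphereMean_mulVec (Matrix.of v) hU
    (g := fun z => z i * z i * star (z i) * star (z i)) (by fun_prop)
  have hz : ∀ z : Fin d → ℂ, (Matrix.of v *ᵥ z) i = s * (z i + z j) := by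
    intro z
    change v i ⬝ᵥ z = _
    simp [v, add_dotProduct, mul_add]
  have hs4 : s * s * (s * s) = 1 / 4 := by rw [hss]; norm_num
  have hexp : (fun z : Fin d → ℂ => (fun z : Fin d → ℂ => z i * z i * star (z i) * star (z i))
      (Matrix.of v *ᵥ z)) = fun z => (1 / 4) * (z i * z i * star (z i) * star (z i) +
        (z j * z j * star (z j) * star (z j) + (4 * (z i * z j * star (z i) * star (z j)) +
        (2 * (z i * z i * star (z i) * star (z j)) + (2 * (z i * z j * star (z i) * star (z i)) +
        (2 * (z j * z j * star (z i) * star (z j)) + (2 * (z i * z j * star (z j) * star (z j)) +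
        (z i * z i * star (z j) * star (z j) + z j * z j * star (z i) * star (z i))))))))) := by
    ext z
    simp only [hz, star_mul', star_add, hstar]
    linear_combination ((z i + z j) * (z i + z j) * (star (z i) + star (z j)) *
      (star (z i) + star (z j))) * hs4
  rw [hexp, sphereMean_const_mul] at key
  repeat rw [sphereMean_add (by fun_prop) (by fun_prop)] at key
  simp only [sphereMean_const_mul] at key
  simp only [show ∀ a b k l : Fin d,
    sphereMean d (fun z => z a * z b * star (z k) * star (z l)) = moment d a b k l
    from fun _ _ _ _ => rfl] at key
  rw [moment_eq_zero (i := i) (j := i) (k := i) (l := j) (by simp [hij]) (by simp [hij]),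
    moment_eq_zero (i := i) (j := j) (k := i) (l := i) (by simp [hij.symm]) (by simp [hij.symm]),
    moment_eq_zero (i := j) (j := j) (k := i) (l := j) (by simp [hij.symm]) (by simp [hij.symm]),
    moment_eq_zero (i := i) (j := j) (k := j) (l := j) (by simp [hij]) (by simp [hij]),
    moment_eq_zero (i := i) (j := i) (k := j) (l := j) (by simp [hij]) (by simp [hij]),
    moment_eq_zero (i := j) (j := j) (k := i) (l := i) (by simp [hij.symm]) (by simp [hij.symm])]
    at key
  linear_combination (-4) * key

/-- The moments `moment d i j i j` add up to one, the fourth power of the norm of a unit vector. -/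
lemma sum_moment {d : ℕ} (hd : 0 < d) : ∑ i : Fin d, ∑ j : Fin d, moment d i j i j = 1 := by
  have h1 : sphereMean d (fun z => ∑ i : Fin d, ∑ j : Fin d, z i * z j * star (z i) * star (z j))
      = ∑ i : Fin d, ∑ j : Fin d, moment d i j i j := by
    rw [sphereMean_sum _ (fun i => by fun_prop)]
    refine Finset.sum_congr rfl fun i _ => ?_
    rw [sphereMean_sum _ (fun i => by fun_prop)]
    rfl
  have : Nonempty (Fin d) := ⟨⟨0, hd⟩⟩
  have hne : (MeasureTheory.volume : MeasureTheory.Measure (EuclideanSpace ℂ (Fin d))).toSphere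
      ≠ 0 := MeasureTheory.Measure.toSphere_ne_zero _
  have : NeZero (MeasureTheory.volume :
      MeasureTheory.Measure (EuclideanSpace ℂ (Fin d))).toSphere := ⟨hne⟩
  rw [← h1]
  unfold sphereMean
  have : (fun ψ : Metric.sphere (0 : EuclideanSpace ℂ (Fin d)) 1 =>
      ∑ i : Fin d, ∑ j : Fin d, (ψ : EuclideanSpace ℂ (Fin d)).ofLp i *
        (ψ : EuclideanSpace ℂ (Fin d)).ofLp j * star ((ψ : EuclideanSpace ℂ (Fin d)).ofLp i) *
        star ((ψ : EuclideanSpace ℂ (Fin d)).ofLp j)) = fun _ => (1 : ℂ) := by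
    ext ψ
    have hn : ∑ i : Fin d, (ψ : EuclideanSpace ℂ (Fin d)).ofLp i *
        star ((ψ : EuclideanSpace ℂ (Fin d)).ofLp i) = 1 := by
      have h := EuclideanSpace.norm_sq_eq (ψ : EuclideanSpace ℂ (Fin d))
      rw [mem_sphere_zero_iff_norm.1 ψ.2] at h
      have h2 : ∀ c : ℂ, c * star c = ((‖c‖ ^ 2 : ℝ) : ℂ) := fun c => by
        rw [Complex.star_def, Complex.mul_conj, Complex.normSq_eq_norm_sq]
      simp only [h2, ← Complex.ofReal_sum, ← h]
      norm_num
    have : ∀ i j : Fin d, (ψ : EuclideanSpace ℂ (Fin d)).ofLp i *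
        (ψ : EuclideanSpace ℂ (Fin d)).ofLp j * star ((ψ : EuclideanSpace ℂ (Fin d)).ofLp i) *
        star ((ψ : EuclideanSpace ℂ (Fin d)).ofLp j) =
        ((ψ : EuclideanSpace ℂ (Fin d)).ofLp i * star ((ψ : EuclideanSpace ℂ (Fin d)).ofLp i)) *
        ((ψ : EuclideanSpace ℂ (Fin d)).ofLp j * star ((ψ : EuclideanSpace ℂ (Fin d)).ofLp j)) :=
      fun i j => by ring
    simp only [this, ← Finset.mul_sum, hn, mul_one]
  rw [this, MeasureTheory.average_const]

/-- Only the moments with `{i, j} = {k, l}` are nonzero. Rotation invariance makes all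
`moment d i i i i` equal and twice as large as `moment d i j i j` for `i ≠ j`, and normalization
determines them. -/
theorem moment_eq {d : ℕ} (i j k l : Fin d) :
    moment d i j k l = ((if i = k ∧ j = l then 1 else 0) + (if i = l ∧ j = k then 1 else 0)) /
      ((d : ℂ) * (d + 1)) := by
  have hd : 0 < d := i.pos
  have hdc : (d : ℂ) ≠ 0 := by exact_mod_cast hd.ne'
  have hdc1 : (d : ℂ) + 1 ≠ 0 := by exact_mod_cast Nat.succ_ne_zero d
  have h4 : ∀ a b : Fin d, moment d a a a a = moment d b b b b := by
    intro a b
    by_cases hab : a = b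
    · rw [hab]
    · have h1 := moment_hadamard hab
      have h2 := moment_hadamard (Ne.symm hab)
      have h3 : moment d b a b a = moment d a b a b := by
        rw [moment_comm_left, moment_comm_right]
      rw [h3] at h2
      linear_combination (h1 - h2) / 4
  have h22 : ∀ a b : Fin d, a ≠ b → moment d a b a b = moment d i i i i / 2 := by
    intro a b hab
    have h1 := moment_hadamard hab
    rw [h4 a i, h4 b i] at h1
    linear_combination (-1 / 4) * h1
  have hsum := sum_moment hd
  obtain ⟨c, hc⟩ : ∃ c, c = moment d i i i i := ⟨_, rfl⟩
  have hrow : ∀ a b : Fin d, moment d a b a b = c / 2 + if a = b then c / 2 else 0 := by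
    intro a b
    rw [hc]
    by_cases hab : a = b
    · subst hab; rw [h4 a i]; simp
    · rw [h22 a b hab]; simp [hab]
  simp only [hrow, Finset.sum_add_distrib, Finset.sum_ite_eq, Finset.mem_univ, if_true,
    Finset.sum_const, Finset.card_univ, Fintype.card_fin, nsmul_eq_mul] at hsum
  have hval : moment d i i i i = 2 / ((d : ℂ) * (d + 1)) := by
    rw [← hc]
    field_simp
    linear_combination 2 * hsum
  by_cases h1 : i = k ∧ j = l
  · obtain ⟨rfl, rfl⟩ := h1
    by_cases hij : i = j
    · subst hij; simp [hval]; ring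
    · rw [h22 i j hij, hval]; simp [hij]; field_simp
  · by_cases h2 : i = l ∧ j = k
    · obtain ⟨rfl, rfl⟩ := h2
      have hij : i ≠ j := fun h => h1 ⟨h, h.symm⟩
      rw [moment_comm_right, h22 i j hij, hval]; simp [hij]; field_simp
    · rw [moment_eq_zero h1 h2]; simp [h1, h2]

/-! ### Average fidelity of linear maps -/

/-- The average fidelity of a linear map depends only on its Choi matrix, through the trace and the
overlap with the maximally entangled vector. -/
theorem avgFidelity_linear {d : ℕ} (N : Op (Fin d) →ₗ[ℂ] Op (Fin d)) :
    avgFidelity d N = ((∑ i, ∑ b, (N (Matrix.single i i 1) b b + N (Matrix.single i b 1) i b)) /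
      ((d : ℂ) * (d + 1))).re := by
  have hexp : ∀ z : Fin d → ℂ, star z ⬝ᵥ (N (pureState z) *ᵥ z) =
      ∑ i, ∑ j, ∑ b, ∑ c, N (Matrix.single i j 1) b c * (z i * z c * star (z j) * star (z b)) := by
    intro z
    have hp : pureState z = ∑ i, ∑ j, (z i * star (z j)) • Matrix.single i j (1 : ℂ) := by
      conv_lhs => rw [Matrix.matrix_eq_sum_single (pureState z)]
      simp [pureState, Matrix.vecMulVec_apply, Matrix.smul_single]
    rw [hp]
    simp only [map_sum, map_smul, Matrix.sum_mulVec, dotProduct_sum, Matrix.smul_mulVec,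
      dotProduct_smul, smul_eq_mul]
    refine Finset.sum_congr rfl fun i _ => Finset.sum_congr rfl fun j _ => ?_
    simp only [dotProduct, Matrix.mulVec, Finset.mul_sum, Pi.star_apply]
    refine Finset.sum_congr rfl fun b _ => Finset.sum_congr rfl fun c _ => ?_
    ring
  have hcont : Continuous fun z : Fin d → ℂ => star z ⬝ᵥ (N (pureState z) *ᵥ z) := by
    simp_rw [hexp]; fun_prop
  have h1 : avgFidelity d N = (sphereMean d fun z => star z ⬝ᵥ (N (pureState z) *ᵥ z)).re := by
    unfold avgFidelity sphereMean
    rw [MeasureTheory.average_eq, MeasureTheory.average_eq, Complex.smul_re]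
    congr 1
    exact integral_re (integrable_sphere hcont)
  rw [h1]
  congr 1
  simp_rw [hexp]
  have hm : ∀ i j b c, sphereMean d (fun z => N (Matrix.single i j 1) b c *
      (z i * z c * star (z j) * star (z b))) =
      N (Matrix.single i j 1) b c * moment d i c j b := fun i j b c => sphereMean_const_mul _ _
  rw [sphereMean_sum _ fun i => by fun_prop]
  simp_rw [fun i => sphereMean_sum (d := d) Finset.univ (g := fun j z => ∑ b, ∑ c,
    N (Matrix.single i j 1) b c * (z i * z c * star (z j) * star (z b))) fun j => by fun_prop,
    fun i j => sphereMean_sum (d := d) Finset.univ (g := fun b z => ∑ c,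
    N (Matrix.single i j 1) b c * (z i * z c * star (z j) * star (z b))) fun j => by fun_prop,
    fun i j b => sphereMean_sum (d := d) Finset.univ (g := fun c z =>
    N (Matrix.single i j 1) b c * (z i * z c * star (z j) * star (z b))) fun j => by fun_prop,
    hm, moment_eq, mul_div_assoc', ← Finset.sum_div, mul_add, Finset.sum_add_distrib]
  congr 2
  · refine Finset.sum_congr rfl fun i _ => ?_
    rw [Finset.sum_eq_single i (fun j _ hj => by simp [hj.symm]) (by simp)]
    refine Finset.sum_congr rfl fun b _ => ?_
    simp
  · refine Finset.sum_congr rfl fun i _ => Finset.sum_congr rfl fun j _ => ?_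
    rw [Finset.sum_eq_single i (fun b _ hb => by simp [hb.symm]) (by simp)]
    simp

/-! ### Kraus form of LOCC maps -/

/-- A measurement, followed by a measurement that depends on its outcome, is a measurement. -/
lemma sum_conjTranspose_mul_comp {ι a b c : Type} [Fintype ι] {κ : ι → Type}
    [∀ i, Fintype (κ i)] [Fintype a] [DecidableEq a] [Fintype b] [DecidableEq b] [Fintype c]
    (P : ι → Matrix b a ℂ) (Q : ∀ i, κ i → Matrix c b ℂ) (hP : ∑ i, (P i)ᴴ * P i = 1)
    (hQ : ∀ i, ∑ j, (Q i j)ᴴ * Q i j = 1) :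
    ∑ k : Σ i, κ i, (Q k.1 k.2 * P k.1)ᴴ * (Q k.1 k.2 * P k.1) = 1 := by
  have h : ∀ i j, (Q i j * P i)ᴴ * (Q i j * P i) = (P i)ᴴ * ((Q i j)ᴴ * Q i j) * P i := by
    intro i j
    rw [Matrix.conjTranspose_mul]
    simp only [Matrix.mul_assoc]
  rw [Fintype.sum_sigma]
  simp only [h, ← Matrix.sum_mul, ← Matrix.mul_sum, hQ, Matrix.mul_one, hP]

lemma sum_conjTranspose_mul_kronecker_one {ι a b c : Type} [Fintype ι] [Fintype a] [DecidableEq a]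
    [Fintype b] [Fintype c] [DecidableEq c] (K : ι → Matrix b a ℂ)
    (hK : ∑ i, (K i)ᴴ * K i = 1) :
    ∑ i, (K i ⊗ₖ (1 : Op c))ᴴ * (K i ⊗ₖ (1 : Op c)) = 1 := by
  simp only [Matrix.conjTranspose_kronecker, ← Matrix.mul_kronecker_mul,
    Matrix.conjTranspose_one, Matrix.mul_one]
  rw [← Matrix.one_kronecker_one, ← hK]
  ext ⟨x, y⟩ ⟨x', y'⟩
  simp only [Matrix.sum_apply, Matrix.kronecker_apply, Finset.sum_mul]

lemma sum_conjTranspose_mul_one_kronecker {ι a b c : Type} [Fintype ι] [Fintype a] [DecidableEq a]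
    [Fintype b] [Fintype c] [DecidableEq c] (K : ι → Matrix b a ℂ)
    (hK : ∑ i, (K i)ᴴ * K i = 1) :
    ∑ i, ((1 : Op c) ⊗ₖ K i)ᴴ * ((1 : Op c) ⊗ₖ K i) = 1 := by
  simp only [Matrix.conjTranspose_kronecker, ← Matrix.mul_kronecker_mul,
    Matrix.conjTranspose_one, Matrix.mul_one]
  rw [← Matrix.one_kronecker_one, ← hK]
  ext ⟨x, y⟩ ⟨x', y'⟩
  simp only [Matrix.sum_apply, Matrix.kronecker_apply, Finset.mul_sum]

/-- Every LOCC map is a trace preserving completely positive map with product Kraus operators. -/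
theorem IsLOCC.exists_kraus {A B C D : Type} [Fintype A] [DecidableEq A] [Fintype B]
    [DecidableEq B] [Fintype C] [DecidableEq C] [Fintype D] [DecidableEq D]
    {Λ : Op (A × B) → Op (C × D)} (h : IsLOCC Λ) :
    ∃ (ι : Type) (_ : Fintype ι) (K : ι → Matrix C A ℂ) (L : ι → Matrix D B ℂ),
      ∑ k, (K k ⊗ₖ L k)ᴴ * (K k ⊗ₖ L k) = 1 ∧
      ∀ X, Λ X = ∑ k, (K k ⊗ₖ L k) * X * (K k ⊗ₖ L k)ᴴ := by
  induction h with
  | done => exact ⟨Unit, inferInstance, fun _ => 1, fun _ => 1, by simp, by simp⟩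
  | @alice A B A' _ _ _ _ _ _ r K hK Λ _ ih =>
    choose ι hι M N h1 h2 using ih
    have hk : ∀ i j, (M i j * K i) ⊗ₖ N i j = (M i j ⊗ₖ N i j) * (K i ⊗ₖ (1 : Op B)) := by
      intro i j
      rw [← Matrix.mul_kronecker_mul, Matrix.mul_one]
    refine ⟨Σ i, ι i, inferInstance, fun k => M k.1 k.2 * K k.1, fun k => N k.1 k.2, ?_, ?_⟩
    · simp only [hk]
      exact sum_conjTranspose_mul_comp (fun i => K i ⊗ₖ (1 : Op B)) (fun i j => M i j ⊗ₖ N i j)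
        (sum_conjTranspose_mul_kronecker_one K hK) h1
    · intro X
      rw [Fintype.sum_sigma]
      refine Finset.sum_congr rfl fun i _ => ?_
      rw [h2]
      refine Finset.sum_congr rfl fun j _ => ?_
      rw [hk, Matrix.conjTranspose_mul]
      simp only [Matrix.mul_assoc]
  | @bob A B B' _ _ _ _ _ _ r K hK Λ _ ih =>
    choose ι hι M N h1 h2 using ih
    have hk : ∀ i j, M i j ⊗ₖ (N i j * K i) = (M i j ⊗ₖ N i j) * ((1 : Op A) ⊗ₖ K i) := by
      intro i j
      rw [← Matrix.mul_kronecker_mul, Matrix.mul_one]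
    refine ⟨Σ i, ι i, inferInstance, fun k => M k.1 k.2, fun k => N k.1 k.2 * K k.1, ?_, ?_⟩
    · simp only [hk]
      exact sum_conjTranspose_mul_comp (fun i => (1 : Op A) ⊗ₖ K i) (fun i j => M i j ⊗ₖ N i j)
        (sum_conjTranspose_mul_one_kronecker K hK) h1
    · intro X
      rw [Fintype.sum_sigma]
      refine Finset.sum_congr rfl fun i _ => ?_
      rw [h2]
      refine Finset.sum_congr rfl fun j _ => ?_
      rw [hk, Matrix.conjTranspose_mul]
      simp only [Matrix.mul_assoc]

section
variable {A B C D : Type} [Fintype A] [DecidableEq A] [Fintype B]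
    [DecidableEq B] [Fintype C] [DecidableEq C] [Fintype D] [DecidableEq D]

lemma IsLOCC.exists_linearMap {Λ : Op (A × B) → Op (C × D)} (h : IsLOCC Λ) :
    ∃ N : Op (A × B) →ₗ[ℂ] Op (C × D), ⇑N = Λ := by
  obtain ⟨ι, _, K, L, -, hΛ⟩ := h.exists_kraus
  refine ⟨⟨⟨Λ, fun X Y => ?_⟩, fun c X => ?_⟩, rfl⟩
  · simp only [hΛ, Matrix.mul_add, Matrix.add_mul, Finset.sum_add_distrib]
  · simp only [hΛ, Matrix.mul_smul, Matrix.smul_mul, Finset.smul_sum, RingHom.id_apply]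

lemma IsLOCC.trace_apply {Λ : Op (A × B) → Op (C × D)} (h : IsLOCC Λ) (X : Op (A × B)) :
    (Λ X).trace = X.trace := by
  obtain ⟨ι, _, K, L, h1, hΛ⟩ := h.exists_kraus
  rw [hΛ, Matrix.trace_sum]
  simp_rw [fun k => Matrix.trace_mul_cycle (K k ⊗ₖ L k) X (K k ⊗ₖ L k)ᴴ]
  rw [← Matrix.trace_sum, ← Matrix.sum_mul, h1, Matrix.one_mul]

lemma IsLOCC.posSemidef {Λ : Op (A × B) → Op (C × D)} (h : IsLOCC Λ) {X : Op (A × B)}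
    (hX : X.PosSemidef) : (Λ X).PosSemidef := by
  obtain ⟨ι, _, K, L, -, hΛ⟩ := h.exists_kraus
  rw [hΛ]
  exact Matrix.posSemidef_sum _ fun k _ => hX.mul_mul_conjTranspose_same _

/-- A measurement by Alice whose outcomes are labelled by an arbitrary finite type. -/
lemma IsLOCC.alice' {A' ι : Type} [Fintype A'] [DecidableEq A'] [Fintype ι]
    (K : ι → Matrix A' A ℂ) (hK : ∑ i, (K i)ᴴ * K i = 1) (Λ : ι → Op (A' × B) → Op (C × D))
    (hΛ : ∀ i, IsLOCC (Λ i)) :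
    IsLOCC (fun X : Op (A × B) => ∑ i, Λ i ((K i ⊗ₖ (1 : Op B)) * X * (K i ⊗ₖ (1 : Op B))ᴴ)) := by
  let e := (Fintype.equivFin ι).symm
  have := IsLOCC.alice (B := B) (fun i => K (e i))
    (by rw [← hK]; exact e.sum_comp fun i => (K i)ᴴ * K i) (fun i => Λ (e i)) fun i => hΛ _
  convert this using 2 with X
  exact (e.sum_comp fun i => Λ i ((K i ⊗ₖ (1 : Op B)) * X * (K i ⊗ₖ (1 : Op B))ᴴ)).symm

/-- A measurement by Bob whose outcomes are labelled by an arbitrary finite type. -/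
lemma IsLOCC.bob' {B' ι : Type} [Fintype B'] [DecidableEq B'] [Fintype ι]
    (K : ι → Matrix B' B ℂ) (hK : ∑ i, (K i)ᴴ * K i = 1) (Λ : ι → Op (A × B') → Op (C × D))
    (hΛ : ∀ i, IsLOCC (Λ i)) :
    IsLOCC (fun X : Op (A × B) => ∑ i, Λ i (((1 : Op A) ⊗ₖ K i) * X * ((1 : Op A) ⊗ₖ K i)ᴴ)) := by
  let e := (Fintype.equivFin ι).symm
  have := IsLOCC.bob (A := A) (fun i => K (e i))
    (by rw [← hK]; exact e.sum_comp fun i => (K i)ᴴ * K i) (fun i => Λ (e i)) fun i => hΛ _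
  convert this using 2 with X
  exact (e.sum_comp fun i => Λ i (((1 : Op A) ⊗ₖ K i) * X * ((1 : Op A) ⊗ₖ K i)ᴴ)).symm

/-! ### A criterion for uselessness -/

/-- The unnormalized projector `d φ_d = ∑ |i,i⟩⟨j,j|`. -/
def unnormEnt (d : ℕ) : Op (Fin d × Fin d) :=
  Matrix.of fun p q => if p.1 = p.2 ∧ q.1 = q.2 then 1 else 0

lemma smul_maxEnt {d : ℕ} (hd : 0 < d) : (d : ℂ) • maxEnt d = unnormEnt d := by
  have hs : ((Real.sqrt d : ℝ) : ℂ) * (Real.sqrt d : ℝ) = d := by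
    rw [← Complex.ofReal_mul, Real.mul_self_sqrt (Nat.cast_nonneg d)]; simp
  have hne : ((Real.sqrt d : ℝ) : ℂ) ≠ 0 := by
    intro h; rw [h, mul_zero] at hs; exact hd.ne (by exact_mod_cast hs)
  ext p q
  by_cases hp : p.1 = p.2 <;> by_cases hq : q.1 = q.2 <;>
    simp [maxEnt, pureState, maxEntVec, unnormEnt, Matrix.vecMulVec_apply, hp, hq]
  rw [← mul_inv, hs, mul_inv_cancel₀]
  exact_mod_cast hd.ne'

lemma trace_mul_unnormEnt {d : ℕ} (M : Op (Fin d × Fin d)) :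
    (M * unnormEnt d).trace = ∑ i, ∑ j, M (i, i) (j, j) := by
  simp only [Matrix.trace, Matrix.diag, Matrix.mul_apply, unnormEnt, Matrix.of_apply,
    Fintype.sum_prod_type, mul_ite, mul_one, mul_zero, ite_and, Finset.sum_ite_eq,
    Finset.mem_univ, if_true]
  simp

/-- A state all of whose local filterings onto `ℂ^d ⊗ ℂ^d` have fidelity at most `1 / d` with `φ_d`
is useless for teleportation. -/
theorem mem_useless_of_filter {d : ℕ} (hd : 0 < d) {ρ : Op (A × B)} (hρ : IsState ρ)
    (h : ∀ (K : Matrix (Fin d) A ℂ) (L : Matrix (Fin d) B ℂ),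
      0 ≤ ((K ⊗ₖ L) * ρ * (K ⊗ₖ L)ᴴ * (1 - unnormEnt d)).trace.re) :
    ρ ∈ Useless d A B := by
  refine ⟨hρ, fun Ω hΩ => ?_⟩
  obtain ⟨W, rfl⟩ := hΩ.exists_linearMap
  obtain ⟨ι, _, K, L, -, hΛ⟩ := hΩ.exists_kraus
  let N : Op (Fin d) →ₗ[ℂ] Op (Fin d) :=
    { toFun := fun χ => (W ((χ ⊗ₖ ρ).submatrix (fun p => (p.1.1, (p.1.2, p.2)))
        fun p => (p.1.1, (p.1.2, p.2)))).submatrix (fun b => ((), b)) fun b => ((), b)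
      map_add' := fun χ χ' => by
        rw [Matrix.add_kronecker]
        exact congrArg
          (fun Z : Op (Unit × Fin d) => Z.submatrix (fun b => ((), b)) fun b => ((), b))
          (map_add W _ _)
      map_smul' := fun c χ => by
        rw [Matrix.smul_kronecker]
        exact congrArg
          (fun Z : Op (Unit × Fin d) => Z.submatrix (fun b => ((), b)) fun b => ((), b))
          (map_smul W c _) }
  -- `M` is the Choi matrix of the protocol `N`, a sum of filterings of `ρ` by its Kraus operators,
  -- in which Alice's input system is read as an output.
  let M : Op (Fin d × Fin d) := ∑ k, ((Matrix.of fun i a => K k () (i, a)) ⊗ₖ L k) * ρ *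
    ((Matrix.of fun i a => K k () (i, a)) ⊗ₖ L k)ᴴ
  have hN : ∀ i j b c, N (Matrix.single i j 1) b c = M (i, b) (j, c) := by
    intro i j b c
    change (W _) ((), b) ((), c) = _
    simp only [hΛ, M, Matrix.sum_apply]
    refine Finset.sum_congr rfl fun k _ => ?_
    simp only [Matrix.mul_apply, Matrix.kronecker_apply, Matrix.conjTranspose_apply,
      Matrix.submatrix_apply, Matrix.of_apply, Fintype.sum_prod_type, Matrix.single_apply]
    rw [Finset.sum_eq_single j (fun x _ hx => by simp [hx.symm]) (by simp)]
    refine Finset.sum_congr rfl fun a _ => Finset.sum_congr rfl fun b' _ => ?_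
    congr 1
    rw [Finset.sum_eq_single i (fun x _ hx => by simp [hx.symm]) (by simp)]
    simp
  have htr : M.trace = d := by
    have h1 : ∀ i, (N (Matrix.single i i 1)).trace = 1 := by
      intro i
      have : (N (Matrix.single i i 1)).trace = (W ((Matrix.single i i (1 : ℂ) ⊗ₖ ρ).submatrix
          (fun p => (p.1.1, (p.1.2, p.2))) fun p => (p.1.1, (p.1.2, p.2)))).trace := by
        simp [Matrix.trace, Fintype.sum_prod_type, N]
      rw [this, hΩ.trace_apply]
      have : ((Matrix.single i i (1 : ℂ) ⊗ₖ ρ).submatrix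
          (fun p : (Fin d × A) × B => (p.1.1, (p.1.2, p.2)))
          fun p => (p.1.1, (p.1.2, p.2))).trace = (Matrix.single i i (1 : ℂ) ⊗ₖ ρ).trace := by
        simp only [Matrix.trace, Matrix.diag, Matrix.submatrix_apply, Fintype.sum_prod_type]
      rw [this, Matrix.trace_kronecker, hρ.2]
      simp
    calc M.trace = ∑ i, (N (Matrix.single i i 1)).trace := by
          simp only [Matrix.trace, Matrix.diag, Fintype.sum_prod_type, hN]
      _ = d := by simp [h1]
  have hM : 0 ≤ (M * (1 - unnormEnt d)).trace.re := by
    simp only [M]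
    rw [Matrix.sum_mul, Matrix.trace_sum, Complex.re_sum]
    exact Finset.sum_nonneg fun k _ => h _ _
  change avgFidelity d N ≤ _
  rw [avgFidelity_linear]
  have : ∑ i, ∑ b, (N (Matrix.single i i 1) b b + N (Matrix.single i b 1) i b) =
      M.trace + (M * unnormEnt d).trace := by
    simp only [hN, Finset.sum_add_distrib, trace_mul_unnormEnt]
    simp [Matrix.trace, Fintype.sum_prod_type]
  rw [this]
  rw [Matrix.mul_sub, Matrix.mul_one, Matrix.trace_sub, Complex.sub_re] at hM
  have hd' : (0 : ℝ) < d := by exact_mod_cast hd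
  have hden : ((d : ℂ) * (d + 1)) = ((d * (d + 1) : ℝ) : ℂ) := by push_cast; rfl
  rw [hden, Complex.div_ofReal_re, Complex.add_re, fClass, div_le_div_iff₀ (by positivity)
    (by positivity)]
  have h1 : M.trace.re = d := by rw [htr]; simp
  rw [h1] at hM ⊢
  nlinarith

end

/-! ### Weyl operators and standard teleportation -/

section
variable {d : ℕ}

lemma weyl_phase_mul_star (n : ℕ) :
    star (Complex.exp (2 * Real.pi * Complex.I / d) ^ n) *
      Complex.exp (2 * Real.pi * Complex.I / d) ^ n = 1 := by
  rw [star_pow, ← mul_pow, Complex.star_def, Complex.conj_mul', Complex.norm_exp]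
  simp [Complex.div_natCast_re]

lemma weyl_unitary (hd : 0 < d) (j k : Fin d) : (weyl d j k)ᴴ * weyl d j k = 1 := by
  have : NeZero d := ⟨hd.ne'⟩
  ext a b
  rw [Matrix.mul_apply, Matrix.one_apply, Finset.sum_eq_single (a + k)
    (fun c _ hc => by simp [weyl, hc]) (by simp)]
  by_cases hab : a = b
  · subst hab
    simpa [weyl, Matrix.conjTranspose_apply] using weyl_phase_mul_star ((j : ℕ) * (a : ℕ))
  · simp [weyl, hab]

/-- The Weyl operators form an orthogonal basis of the space of operators. -/
lemma sum_weyl_mul_star (hd : 0 < d) (a b a' b' : Fin d) :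
    ∑ j, ∑ k, weyl d j k a b * star (weyl d j k a' b') =
      if a = a' ∧ b = b' then (d : ℂ) else 0 := by
  have : NeZero d := ⟨hd.ne'⟩
  have hw := Complex.isPrimitiveRoot_exp d hd.ne'
  set w := Complex.exp (2 * Real.pi * Complex.I / d) with hwdef
  have hk : ∀ j : Fin d, ∑ k, weyl d j k a b * star (weyl d j k a' b') =
      if a - b = a' - b' then (w ^ (b : ℕ) * star (w ^ (b' : ℕ))) ^ (j : ℕ) else 0 := by
    intro j
    rw [Finset.sum_eq_single (a - b) (fun k _ hk => ?_) (by simp)]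
    · by_cases h : a - b = a' - b'
      · have h2 : a' = b' + (a - b) := by rw [h]; abel
        have h1 : a = b + (a - b) := by abel
        simp only [weyl, Matrix.of_apply, if_pos h1, if_pos h2, ← hwdef, if_pos h]
        rw [mul_pow, star_pow, star_pow, ← pow_mul, ← pow_mul, mul_comm (b : ℕ),
          mul_comm (b' : ℕ)]
      · have h2 : a' ≠ b' + (a - b) := fun h3 => h (by rw [h3]; abel)
        simp [weyl, h2, h]
    · have : a ≠ b + k := fun h3 => hk (by rw [h3]; abel)
      simp [weyl, this]
  simp only [hk]
  by_cases h : a - b = a' - b'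
  · simp only [h, if_true]
    by_cases hb : b = b'
    · subst hb
      have ha : a = a' := by simpa using h
      have h1 : w ^ (b : ℕ) * star (w ^ (b : ℕ)) = 1 := by
        rw [mul_comm]; exact weyl_phase_mul_star (b : ℕ)
      simp only [h1, ha, one_pow]
      simp
    · rw [if_neg (fun h => hb h.2)]
      set z := w ^ (b : ℕ) * star (w ^ (b' : ℕ)) with hz
      have hz1 : z ≠ 1 := by
        intro h1
        apply hb
        apply Fin.ext
        apply hw.pow_inj b.2 b'.2
        calc w ^ (b : ℕ) = w ^ (b : ℕ) * (star (w ^ (b' : ℕ)) * w ^ (b' : ℕ)) := by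
              rw [weyl_phase_mul_star, mul_one]
          _ = z * w ^ (b' : ℕ) := by rw [hz]; ring
          _ = w ^ (b' : ℕ) := by rw [h1, one_mul]
      have hzd : z ^ d = 1 := by
        rw [hz, mul_pow, ← pow_mul, mul_comm, ← star_pow, ← pow_mul, mul_comm (b : ℕ),
          mul_comm (b' : ℕ), pow_mul, pow_mul, hw.pow_eq_one]
        simp
      rw [Fin.sum_univ_eq_sum_range (fun i => z ^ i) d]
      have := geom_sum_mul z d
      rw [hzd, sub_self] at this
      exact (mul_eq_zero.1 this).resolve_right (sub_ne_zero.2 hz1)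
  · have h3 : ¬(a = a' ∧ b = b') := fun h4 => h (by rw [h4.1, h4.2])
    simp [h, h3]

lemma inv_sqrt_mul_self : ((1 / Real.sqrt d : ℝ) : ℂ) * ((1 / Real.sqrt d : ℝ) : ℂ) = 1 / d := by
  rw [← Complex.ofReal_mul, div_mul_div_comm, Real.mul_self_sqrt (Nat.cast_nonneg d)]
  simp

lemma bellVec_apply (j k : Fin d) (p : Fin d × Fin d) :
    bellVec d j k p = ((1 / Real.sqrt d : ℝ) : ℂ) * weyl d j k p.1 p.2 := by
  simp only [bellVec, Matrix.mulVec, dotProduct, Fintype.sum_prod_type, maxEntVec,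
    Matrix.kroneckerMap_apply, Matrix.one_apply]
  simp [mul_comm]

lemma star_bellVec_apply (j k : Fin d) (p : Fin d × Fin d) :
    star (bellVec d j k p) = ((1 / Real.sqrt d : ℝ) : ℂ) * star (weyl d j k p.1 p.2) := by
  rw [bellVec_apply, star_mul', Complex.star_def, Complex.conj_ofReal]

/-- The projection onto the generalized Bell basis is a complete measurement. -/
lemma sum_bell_projector (hd : 0 < d) :
    ∑ x : Fin d × Fin d, (Matrix.of fun (_ : Unit) p => star (bellVec d x.1 x.2 p))ᴴ *
      (Matrix.of fun (_ : Unit) p => star (bellVec d x.1 x.2 p)) = 1 := by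
  have hdc : (d : ℂ) ≠ 0 := by exact_mod_cast hd.ne'
  ext p q
  have h : ∀ j k, bellVec d j k p * star (bellVec d j k q) =
      (1 / d) * (weyl d j k p.1 p.2 * star (weyl d j k q.1 q.2)) := by
    intro j k
    rw [bellVec_apply, star_bellVec_apply, ← inv_sqrt_mul_self]
    ring
  simp only [Matrix.sum_apply, Matrix.mul_apply, Matrix.conjTranspose_apply, Matrix.of_apply,
    Finset.univ_unique, Finset.sum_singleton, star_star, Fintype.sum_prod_type, h,
    ← Finset.mul_sum, sum_weyl_mul_star hd, Matrix.one_apply, Prod.ext_iff]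
  split_ifs <;> simp [hdc]

/-- `φ_d` is invariant under the local unitaries `conj U ⊗ U`. -/
lemma conj_unnormEnt {U : Op (Fin d)} (hU : Uᴴ * U = 1) :
    ((U.map star) ⊗ₖ U)ᴴ * unnormEnt d * ((U.map star) ⊗ₖ U) = unnormEnt d := by
  have h : ∀ a b : Fin d, ∑ i, U i a * star (U i b) = if a = b then 1 else 0 := by
    intro a b
    have := congrFun (congrFun hU b) a
    rw [Matrix.mul_apply, Matrix.one_apply] at this
    simp only [eq_comm (a := a), ← this]
    exact Finset.sum_congr rfl fun i _ => by rw [Matrix.conjTranspose_apply, mul_comm]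
  have h' : ∀ a b : Fin d, ∑ i, star (U i a) * U i b = if a = b then 1 else 0 := by
    intro a b
    simp only [mul_comm, h, eq_comm]
  have hv : unnormEnt d = Matrix.vecMulVec (fun p => if p.1 = p.2 then 1 else 0)
      (fun p => if p.1 = p.2 then 1 else 0) := by
    ext p q
    by_cases hp : p.1 = p.2 <;> simp [unnormEnt, Matrix.vecMulVec_apply, hp]
  rw [hv, Matrix.mul_vecMulVec, Matrix.vecMulVec_mul]
  congr 1
  · ext ⟨a, b⟩
    simp [Matrix.mulVec, dotProduct, Fintype.sum_prod_type]
    simpa using h a b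
  · ext ⟨a, b⟩
    simp [Matrix.vecMul, dotProduct, Fintype.sum_prod_type]
    simpa using h' a b

/-- The Choi matrix of standard teleportation is the twirl of the resource over the Weyl
operators, up to normalization. -/
lemma standardTeleport_single (τ : Op (Fin d × Fin d)) (i i' c c' : Fin d) :
    standardTeleport d τ (Matrix.single i i' 1) c c' =
      ((1 / d : ℂ) • ∑ j, ∑ k, (((weyl d j k).map star) ⊗ₖ weyl d j k) * τ *
        (((weyl d j k).map star) ⊗ₖ weyl d j k)ᴴ) (i, c) (i', c') := by
  simp only [standardTeleport, Matrix.sum_apply, Matrix.smul_apply, smul_eq_mul, Finset.mul_sum]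
  refine Finset.sum_congr rfl fun j _ => Finset.sum_congr rfl fun k _ => ?_
  simp only [Matrix.mul_apply, Matrix.kroneckerMap_apply, Matrix.conjTranspose_apply,
    Matrix.of_apply, Matrix.map_apply, Fintype.sum_prod_type, Finset.mul_sum, Finset.sum_mul]
  conv_rhs => rw [Finset.sum_comm]
  refine Finset.sum_congr rfl fun b' _ => ?_
  conv_rhs => enter [2, q]; rw [Finset.sum_comm]
  conv_rhs => rw [Finset.sum_comm]
  refine Finset.sum_congr rfl fun b _ => ?_
  rw [Finset.sum_eq_single i (fun x _ hx => by simp [hx.symm]) (by simp)]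
  conv_rhs => rw [Finset.sum_comm]
  refine Finset.sum_congr rfl fun p _ => ?_
  rw [Finset.sum_eq_single i' (fun x _ hx => by simp [hx.symm]) (by simp)]
  refine Finset.sum_congr rfl fun q _ => ?_
  rw [star_bellVec_apply, bellVec_apply, ← inv_sqrt_mul_self]
  simp only [Matrix.single_apply, star_mul', star_star, and_self, if_true]
  ring

/-- The average fidelity of standard teleportation with an arbitrary resource `τ`, without any
twirling. -/
theorem avgFidelity_standardTeleport (hd : 0 < d) (τ : Op (Fin d × Fin d)) :
    avgFidelity d (standardTeleport d τ) =
      ((τ * unnormEnt d).trace.re + τ.trace.re) / (d + 1) := by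
  let N : Op (Fin d) →ₗ[ℂ] Op (Fin d) :=
    { toFun := standardTeleport d τ
      map_add' := fun χ χ' => by
        simp only [standardTeleport, ← Finset.sum_add_distrib, ← Matrix.mul_add, ← Matrix.add_mul]
        refine Finset.sum_congr rfl fun j _ => Finset.sum_congr rfl fun k _ => ?_
        congr 2
        ext b b'
        simp only [Matrix.of_apply, Matrix.add_apply, ← Finset.sum_add_distrib]
        refine Finset.sum_congr rfl fun p _ => Finset.sum_congr rfl fun q _ => ?_
        ring
      map_smul' := fun c χ => by
        simp only [standardTeleport, Finset.smul_sum, RingHom.id_apply]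
        refine Finset.sum_congr rfl fun j _ => Finset.sum_congr rfl fun k _ => ?_
        rw [← Matrix.smul_mul, ← Matrix.mul_smul]
        congr 2
        ext b b'
        simp only [Matrix.of_apply, Matrix.smul_apply, smul_eq_mul, Finset.mul_sum]
        refine Finset.sum_congr rfl fun p _ => Finset.sum_congr rfl fun q _ => ?_
        ring }
  set M : Op (Fin d × Fin d) := (1 / d : ℂ) • ∑ j, ∑ k,
    (((weyl d j k).map star) ⊗ₖ weyl d j k) * τ * (((weyl d j k).map star) ⊗ₖ weyl d j k)ᴴ with hM
  have hdc : (d : ℂ) ≠ 0 := by exact_mod_cast hd.ne'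
  have hN : ∀ i j b c, N (Matrix.single i j 1) b c = M (i, b) (j, c) := fun i j b c =>
    standardTeleport_single τ i j b c
  have h1 : M.trace = d * τ.trace := by
    have : ∀ j k, ((((weyl d j k).map star) ⊗ₖ weyl d j k) * τ *
        (((weyl d j k).map star) ⊗ₖ weyl d j k)ᴴ).trace = τ.trace := by
      intro j k
      have hc : ((weyl d j k).map star)ᴴ * (weyl d j k).map star = 1 := by
        have := congrArg (fun Z : Op (Fin d) => Z.map star) (weyl_unitary hd j k)
        ext a b
        have := congrFun (congrFun this a) b
        simpa [Matrix.mul_apply, Matrix.one_apply, apply_ite] using this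
      rw [Matrix.trace_mul_cycle, Matrix.conjTranspose_kronecker, ← Matrix.mul_kronecker_mul,
        weyl_unitary hd, hc, Matrix.one_kronecker_one, Matrix.one_mul]
    rw [hM, Matrix.trace_smul, Matrix.trace_sum]
    simp only [Matrix.trace_sum, this]
    simp
    field_simp
  have h2 : (M * unnormEnt d).trace = d * (τ * unnormEnt d).trace := by
    have : ∀ j k, ((((weyl d j k).map star) ⊗ₖ weyl d j k) * τ *
        (((weyl d j k).map star) ⊗ₖ weyl d j k)ᴴ * unnormEnt d).trace =
        (τ * unnormEnt d).trace := by
      intro j k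
      rw [Matrix.mul_assoc, Matrix.mul_assoc, Matrix.trace_mul_comm, Matrix.mul_assoc,
        conj_unnormEnt (weyl_unitary hd j k)]
    rw [hM, Matrix.smul_mul, Matrix.trace_smul, Matrix.sum_mul, Matrix.trace_sum]
    simp only [Matrix.sum_mul, Matrix.trace_sum, this]
    simp
    field_simp
  change avgFidelity d N = _
  rw [avgFidelity_linear]
  have : ∑ i, ∑ b, (N (Matrix.single i i 1) b b + N (Matrix.single i b 1) i b) =
      M.trace + (M * unnormEnt d).trace := by
    simp only [hN, Finset.sum_add_distrib, trace_mul_unnormEnt]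
    simp [Matrix.trace, Fintype.sum_prod_type]
  rw [this, h1, h2, ← mul_add, mul_div_mul_left _ _ hdc]
  have hden : ((d : ℂ) + 1) = ((d + 1 : ℝ) : ℂ) := by push_cast; rfl
  rw [hden, Complex.div_ofReal_re, Complex.add_re, add_comm]

lemma trace_unnormEnt : (unnormEnt d).trace = d := by
  simp only [Matrix.trace, Matrix.diag, unnormEnt, Matrix.of_apply, and_self,
    Fintype.sum_prod_type]
  simp

lemma trace_maxEnt (hd : 0 < d) : (maxEnt d).trace = 1 := by
  have hdc : (d : ℂ) ≠ 0 := by exact_mod_cast hd.ne'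
  have h : (d : ℂ) * (maxEnt d).trace = d := by
    rw [← smul_eq_mul, ← Matrix.trace_smul, smul_maxEnt hd, trace_unnormEnt]
  exact mul_left_cancel₀ hdc (by rw [h, mul_one])

lemma unnormEnt_mul_self : unnormEnt d * unnormEnt d = (d : ℂ) • unnormEnt d := by
  ext ⟨a, b⟩ ⟨a', b'⟩
  by_cases hp : a = b <;> by_cases hq : a' = b' <;>
    simp [Matrix.mul_apply, unnormEnt, Fintype.sum_prod_type, hp, hq]

lemma maxEnt_mul_unnormEnt (hd : 0 < d) : maxEnt d * unnormEnt d = unnormEnt d := by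
  have hdc : (d : ℂ) ≠ 0 := by exact_mod_cast hd.ne'
  have : (d : ℂ) • (maxEnt d * unnormEnt d) = (d : ℂ) • unnormEnt d := by
    rw [← Matrix.smul_mul, smul_maxEnt hd, unnormEnt_mul_self]
  exact smul_right_injective _ hdc this

/-- Twirling preserves the overlap with `φ_d`, and `teleportFidelity` depends on nothing else. For
`d = 1` the formula fails, as the isotropic state then has a vanishing denominator. -/
theorem teleportFidelity_eq {A B : Type} (hd : 2 ≤ d) (ρ : Op (A × B))
    (Λ : Op (A × B) → Op (Fin d × Fin d)) :
    teleportFidelity d ρ Λ = ((Λ ρ * unnormEnt d).trace.re + 1) / (d + 1) := by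
  have hd0 : 0 < d := by omega
  have hF : (Λ ρ * unnormEnt d).trace.re = d * singletFraction d ρ Λ := by
    rw [← smul_maxEnt hd0, Matrix.mul_smul, Matrix.trace_smul, smul_eq_mul, singletFraction]
    simp
  rw [hF, teleportFidelity, avgFidelity_standardTeleport hd0]
  generalize singletFraction d ρ Λ = F
  have hd2 : (d : ℝ) ^ 2 - 1 ≠ 0 := by
    have : (2 : ℝ) ≤ d := by exact_mod_cast hd
    nlinarith
  have h1 : ((isotropicState d F * unnormEnt d).trace).re = d * F := by
    rw [isotropicState, Matrix.add_mul, Matrix.smul_mul, Matrix.smul_mul, Matrix.sub_mul,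
      Matrix.one_mul, maxEnt_mul_unnormEnt hd0, sub_self, smul_zero, add_zero,
      Matrix.trace_smul, trace_unnormEnt]
    simp [mul_comm]
  have h2 : (isotropicState d F).trace.re = 1 := by
    rw [isotropicState, Matrix.trace_add, Matrix.trace_smul, Matrix.trace_smul, Matrix.trace_sub,
      trace_maxEnt hd0, Matrix.trace_one]
    simp only [Fintype.card_prod, Fintype.card_fin, Complex.add_re, Complex.smul_re,
      Complex.one_re, Complex.sub_re, Complex.natCast_re, smul_eq_mul]
    push_cast
    rw [show (d : ℝ) * d - 1 = d ^ 2 - 1 by ring, div_mul_cancel₀ _ hd2]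
    ring
  rw [h1, h2]

end

/-! ### Composition of LOCC protocols -/

/-- `id_E ⊗ Λ`, the map `Λ` applied in the presence of a further system `E` of Alice. It is defined
blockwise, so that it makes sense without linearity of `Λ`. -/
def extendLeft {A B C D : Type} (E : Type) (Λ : Op (A × B) → Op (C × D)) (X : Op ((E × A) × B)) :
    Op ((E × C) × D) :=
  Matrix.of fun x y => Λ (X.submatrix (fun p => ((x.1.1, p.1), p.2))
    fun p => ((y.1.1, p.1), p.2)) (x.1.2, x.2) (y.1.2, y.2)

lemma extendLeft_sum {A B C D : Type} (E : Type) {ι : Type} (s : Finset ι)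
    (Λ : ι → Op (A × B) → Op (C × D)) (X : Op ((E × A) × B)) :
    extendLeft E (fun X => ∑ i ∈ s, Λ i X) X = ∑ i ∈ s, extendLeft E (Λ i) X := by
  ext x y
  simp [extendLeft, Matrix.sum_apply]

/-- An LOCC map, applied in the presence of a further system of Alice, may be followed by another
LOCC map. -/
lemma IsLOCC.comp_extendLeft {A B C D C' D' E : Type} [Fintype A] [DecidableEq A] [Fintype B]
    [DecidableEq B] [Fintype C] [DecidableEq C] [Fintype D] [DecidableEq D] [Fintype C']
    [DecidableEq C'] [Fintype D'] [DecidableEq D'] [Fintype E] [DecidableEq E]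
    {Γ : Op ((E × C) × D) → Op (C' × D')} (hΓ : IsLOCC Γ)
    {Λ : Op (A × B) → Op (C × D)} (hΛ : IsLOCC Λ) :
    IsLOCC fun X : Op ((E × A) × B) => Γ (extendLeft E Λ X) := by
  obtain ⟨G, rfl⟩ := hΓ.exists_linearMap
  induction hΛ with
  | done => exact hΓ
  | @alice A B A' _ _ _ _ _ _ r K hK Λ _ ih =>
    have := IsLOCC.alice (B := B) (fun i => (1 : Op E) ⊗ₖ K i)
      (sum_conjTranspose_mul_one_kronecker K hK) _ ih
    convert this using 2 with X
    rw [extendLeft_sum Finset.univ (E := E)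
      (Λ := fun i X => Λ i ((K i ⊗ₖ (1 : Op B)) * X * (K i ⊗ₖ (1 : Op B))ᴴ)), map_sum]
    refine Finset.sum_congr rfl fun i _ => congrArg G ?_
    ext x y
    simp only [extendLeft, Matrix.of_apply]
    congr 1
    ext ⟨p, q⟩ ⟨p', q'⟩
    simp only [Matrix.mul_apply, Matrix.kroneckerMap_apply, Matrix.conjTranspose_apply,
      Matrix.submatrix_apply, Fintype.sum_prod_type, Matrix.one_apply]
    rw [Finset.sum_eq_single y.1.1 (fun e _ he => by simp [he.symm]) (by simp)]
    refine Finset.sum_congr rfl fun a _ => Finset.sum_congr rfl fun b _ => ?_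
    rw [Finset.sum_eq_single x.1.1 (fun e _ he => by simp [he.symm]) (by simp)]
    simp
  | @bob A B B' _ _ _ _ _ _ r K hK Λ _ ih =>
    have := IsLOCC.bob (A := E × A) K hK _ ih
    convert this using 2 with X
    rw [extendLeft_sum Finset.univ (E := E)
      (Λ := fun i X => Λ i (((1 : Op A) ⊗ₖ K i) * X * ((1 : Op A) ⊗ₖ K i)ᴴ)), map_sum]
    refine Finset.sum_congr rfl fun i _ => congrArg G ?_
    ext x y
    simp only [extendLeft, Matrix.of_apply]
    congr 1
    ext ⟨p, q⟩ ⟨p', q'⟩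
    simp only [Matrix.mul_apply, Matrix.kroneckerMap_apply, Matrix.conjTranspose_apply,
      Matrix.submatrix_apply, Fintype.sum_prod_type, Matrix.one_apply, Prod.mk.injEq]
    rw [Finset.sum_eq_single y.1.1 (fun e _ he => by simp [he.symm]) (by simp)]
    refine Finset.sum_congr rfl fun a _ => Finset.sum_congr rfl fun b _ => ?_
    rw [Finset.sum_eq_single x.1.1 (fun e _ he => by simp [he.symm]) (by simp)]
    simp

open scoped MatrixOrder in
lemma exists_eq_mul_conjTranspose {A : Type} [Fintype A] [DecidableEq A] {α : Op A}
    (hα : α.PosSemidef) : ∃ R : Op A, α = R * Rᴴ := by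
  obtain ⟨B, rfl⟩ := CStarAlgebra.nonneg_iff_eq_mul_star_self.mp hα.nonneg
  exact ⟨B, rfl⟩

/-- The Kraus operators of the preparation of the state `R Rᴴ` next to a system `A`, one for each
column of `R`. -/
lemma sum_prepare {A A' A₂ : Type} [Fintype A] [DecidableEq A] [Fintype A'] [DecidableEq A']
    [Fintype A₂] (e : A₂ ≃ A × A') {α : Op A'} (hα : IsState α) {R : Op A'} (hR : α = R * Rᴴ) :
    ∑ i, (Matrix.of fun x a => if (e x).1 = a then R (e x).2 i else 0 : Matrix A₂ A ℂ)ᴴ *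
      (Matrix.of fun x a => if (e x).1 = a then R (e x).2 i else 0 : Matrix A₂ A ℂ) = 1 := by
  have htr := hα.2
  rw [hR, Matrix.trace_mul_comm] at htr
  ext a b
  simp only [Matrix.sum_apply, Matrix.mul_apply, Matrix.conjTranspose_apply, Matrix.of_apply]
  simp_rw [fun i => e.sum_comp fun y => star (if y.1 = a then R y.2 i else 0) *
    (if y.1 = b then R y.2 i else 0), Fintype.sum_prod_type]
  simp_rw [Matrix.one_apply, ← htr]
  by_cases hab : a = b
  · subst hab
    simp only [if_true, Matrix.trace, Matrix.diag, Matrix.mul_apply, Matrix.conjTranspose_apply]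
    refine Finset.sum_congr rfl fun i _ => ?_
    rw [Finset.sum_eq_single a (fun e _ he => by simp [he]) (by simp)]
    simp
  · rw [if_neg hab]
    refine Finset.sum_eq_zero fun i _ => Finset.sum_eq_zero fun c _ =>
      Finset.sum_eq_zero fun c' _ => ?_
    by_cases hc : c = a
    · subst hc; simp [hab]
    · simp [hc]

section
variable {A B A' A₂ B₂ C D : Type} [Fintype A] [DecidableEq A] [Fintype B] [DecidableEq B]
  [Fintype A'] [DecidableEq A'] [Fintype A₂] [DecidableEq A₂] [Fintype B₂] [DecidableEq B₂]
  [Fintype C] [DecidableEq C] [Fintype D] [DecidableEq D]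

/-- Before an LOCC map, Alice may prepare a further system in any state `α`. -/
lemma IsLOCC.prepare_left (e : A₂ ≃ A × A') {α : Op A'} (hα : IsState α)
    {Γ : Op (A₂ × B) → Op (C × D)} (hΓ : IsLOCC Γ) :
    IsLOCC fun X : Op (A × B) => Γ (Matrix.of fun x y =>
      X ((e x.1).1, x.2) ((e y.1).1, y.2) * α (e x.1).2 (e y.1).2) := by
  obtain ⟨R, hR⟩ := exists_eq_mul_conjTranspose hα.1
  obtain ⟨G, rfl⟩ := hΓ.exists_linearMap
  have := IsLOCC.alice' (B := B) _ (sum_prepare e hα hR) (fun _ => G) fun _ => hΓ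
  convert this using 2 with X
  rw [← map_sum]
  congr 1
  ext ⟨x, b⟩ ⟨y, b'⟩
  simp only [Matrix.sum_apply, Matrix.mul_apply, Matrix.kroneckerMap_apply,
    Matrix.conjTranspose_apply, Matrix.of_apply, Fintype.sum_prod_type, Matrix.one_apply, hR,
    Finset.mul_sum]
  refine Finset.sum_congr rfl fun i _ => ?_
  rw [Finset.sum_eq_single (e y).1 (fun c _ hc => by simp [hc.symm]) (by simp),
    Finset.sum_eq_single b' (fun c _ hc => by simp [hc.symm]) (by simp),
    Finset.sum_eq_single (e x).1 (fun c _ hc => by simp [hc.symm]) (by simp),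
    Finset.sum_eq_single b (fun c _ hc => by simp [hc.symm]) (by simp)]
  simp
  ring

/-- Before an LOCC map, Bob may prepare a further system in any state `α`. -/
lemma IsLOCC.prepare_right (e : B₂ ≃ B × A') {α : Op A'} (hα : IsState α)
    {Γ : Op (A × B₂) → Op (C × D)} (hΓ : IsLOCC Γ) :
    IsLOCC fun X : Op (A × B) => Γ (Matrix.of fun x y =>
      X (x.1, (e x.2).1) (y.1, (e y.2).1) * α (e x.2).2 (e y.2).2) := by
  obtain ⟨R, hR⟩ := exists_eq_mul_conjTranspose hα.1
  obtain ⟨G, rfl⟩ := hΓ.exists_linearMap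
  have := IsLOCC.bob' (A := A) _ (sum_prepare e hα hR) (fun _ => G) fun _ => hΓ
  convert this using 2 with X
  rw [← map_sum]
  congr 1
  ext ⟨x, b⟩ ⟨y, b'⟩
  simp only [Matrix.sum_apply, Matrix.mul_apply, Matrix.kroneckerMap_apply,
    Matrix.conjTranspose_apply, Matrix.of_apply, Fintype.sum_prod_type, Matrix.one_apply, hR,
    Finset.mul_sum]
  refine Finset.sum_congr rfl fun i _ => ?_
  rw [Finset.sum_eq_single y (fun c _ hc => by simp [hc.symm]) (by simp),
    Finset.sum_eq_single (e b').1 (fun c _ hc => by simp [hc.symm]) (by simp),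
    Finset.sum_eq_single x (fun c _ hc => by simp [hc.symm]) (by simp),
    Finset.sum_eq_single (e b).1 (fun c _ hc => by simp [hc.symm]) (by simp)]
  simp
  ring

end

/-- Standard teleportation as an LOCC protocol: Alice measures in the generalized Bell basis and
Bob corrects by the Weyl operator of the outcome. -/
lemma isLOCC_teleport {d : ℕ} (hd : 0 < d) :
    ∃ Γ : Op ((Fin d × Fin d) × Fin d) → Op (Unit × Fin d), IsLOCC Γ ∧
      ∀ (χ : Op (Fin d)) (τ : Op (Fin d × Fin d)),
        (Γ (Matrix.of fun x y => χ x.1.1 y.1.1 * τ (x.1.2, x.2) (y.1.2, y.2))).submatrix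
          (fun b => ((), b)) (fun b => ((), b)) = standardTeleport d τ χ := by
  refine ⟨_, IsLOCC.alice' _ (sum_bell_projector hd) _ fun x : Fin d × Fin d =>
    IsLOCC.bob' (fun _ : Unit => weyl d x.1 x.2) (by simp [weyl_unitary hd]) _
      fun _ => IsLOCC.done, fun χ τ => ?_⟩
  ext b b'
  simp only [Finset.univ_unique, Finset.sum_singleton, Matrix.submatrix_apply, Matrix.sum_apply,
    standardTeleport]
  rw [Fintype.sum_prod_type]
  refine Finset.sum_congr rfl fun j _ => Finset.sum_congr rfl fun k _ => ?_
  rw [Matrix.mul_apply, Matrix.mul_apply, Fintype.sum_prod_type]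
  simp only [Finset.univ_unique, Finset.sum_singleton, Matrix.conjTranspose_apply,
    Matrix.kroneckerMap_apply, Matrix.one_apply, PUnit.default_eq_unit, if_true, one_mul]
  refine Finset.sum_congr rfl fun c' _ => ?_
  congr 1
  rw [Matrix.mul_apply, Matrix.mul_apply, Fintype.sum_prod_type]
  simp only [Finset.univ_unique, Finset.sum_singleton,
    Matrix.kroneckerMap_apply, Matrix.one_apply, PUnit.default_eq_unit, if_true, one_mul]
  refine Finset.sum_congr rfl fun c _ => ?_
  congr 1
  rw [Matrix.mul_apply, Fintype.sum_prod_type]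
  simp only [Matrix.of_apply]
  conv_rhs => rw [Finset.sum_comm]
  refine Finset.sum_congr rfl fun q _ => ?_
  rw [Finset.sum_eq_single c' (fun y _ hy => by
    simp [Matrix.kroneckerMap_apply, hy.symm]) (by simp)]
  rw [Matrix.mul_apply, Fintype.sum_prod_type, Finset.sum_mul]
  refine Finset.sum_congr rfl fun p _ => ?_
  rw [Finset.sum_eq_single c (fun y _ hy => by
    simp [Matrix.kroneckerMap_apply, hy.symm]) (by simp)]
  simp [Matrix.kroneckerMap_apply]

/-! ### Separable states do not activate -/

lemma isState_of_mem_sep {A B : Type} [Fintype A] [Fintype B] {π : Op (A × B)}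
    (hπ : π ∈ Sep A B) : IsState π := by
  have hconv : Convex ℝ {π : Op (A × B) | IsState π} := by
    rintro x ⟨hx, hx'⟩ y ⟨hy, hy'⟩ a b ha hb hab
    refine ⟨(hx.smul ha).add (hy.smul hb), ?_⟩
    rw [Matrix.trace_add, Matrix.trace_smul, Matrix.trace_smul, hx', hy', ← add_smul, hab,
      one_smul]
  refine convexHull_min (fun τ hτ => ?_) hconv hπ
  obtain ⟨α, β, hα, hβ, rfl⟩ := hτ
  exact ⟨hα.1.kronecker hβ.1, by rw [Matrix.trace_kronecker, hα.2, hβ.2, one_mul]⟩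

lemma trace_joint {a b a' b' : Type} [Fintype a] [Fintype b] [Fintype a'] [Fintype b']
    (T : Op (a × b)) (R : Op (a' × b')) : (joint T R).trace = T.trace * R.trace := by
  rw [← Matrix.trace_kronecker]
  exact (Equiv.prodProdProdComm a a' b b').sum_comp fun x => (T ⊗ₖ R).diag x

lemma unnormEnt_posSemidef (d : ℕ) : (unnormEnt d).PosSemidef := by
  have hv : unnormEnt d = Matrix.vecMulVec (fun p => if p.1 = p.2 then 1 else 0)
      (star fun p => if p.1 = p.2 then 1 else 0) := by
    ext p q
    by_cases hp : p.1 = p.2 <;> simp [unnormEnt, Matrix.vecMulVec_apply, hp]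
  rw [hv]
  exact Matrix.posSemidef_vecMulVec_self_star _

lemma trace_mul_nonneg {n : Type} [Fintype n] [DecidableEq n] {X Y : Matrix n n ℂ}
    (hX : X.PosSemidef) (hY : Y.PosSemidef) : 0 ≤ (X * Y).trace.re := by
  obtain ⟨R, rfl⟩ := exists_eq_mul_conjTranspose hY
  rw [← Matrix.mul_assoc, Matrix.trace_mul_cycle]
  exact (Complex.le_def.1 (hX.conjTranspose_mul_mul_same R).trace_nonneg).1

section
variable {A B A' B' : Type} [Fintype A] [DecidableEq A] [Fintype B] [DecidableEq B]
  [Fintype A'] [DecidableEq A'] [Fintype B'] [DecidableEq B']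

/-- Preparing `α` and `β`, applying `Λ` and teleporting is a protocol for `ρ` alone. Since it has
the same fidelity as the protocol with twirling, uselessness of `ρ` bounds the latter. -/
theorem teleportFidelity_le_of_product {d : ℕ} (hd : 2 ≤ d) {ρ : Op (A × B)}
    (hρ : ρ ∈ Useless d A B) {Λ : Op ((A × A') × (B × B')) → Op (Fin d × Fin d)} (hΛ : IsLOCC Λ)
    {α : Op A'} {β : Op B'} (hα : IsState α) (hβ : IsState β) :
    teleportFidelity d (joint ρ (α ⊗ₖ β)) Λ ≤ fClass d := by
  have hd0 : 0 < d := by omega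
  obtain ⟨Γ, hΓ, hΓτ⟩ := isLOCC_teleport hd0
  have hΩ := (((hΓ.comp_extendLeft hΛ).prepare_right (Equiv.refl (B × B')) hβ).prepare_left
    (A := Fin d × A) (Equiv.prodAssoc (Fin d) A A').symm hα)
  have h := hρ.2 _ hΩ
  obtain ⟨L, rfl⟩ := hΛ.exists_linearMap
  replace h : avgFidelity d (standardTeleport d (L (joint ρ (α ⊗ₖ β)))) ≤ fClass d := by
    refine le_of_eq_of_le ?_ h
    unfold protocolFidelity
    congr 1
    ext1 χ
    rw [← hΓτ χ]
    refine congrArg (fun Z => (Γ Z).submatrix (fun b => ((), b)) fun b => ((), b)) ?_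
    ext x y
    simp only [extendLeft, Matrix.of_apply]
    rw [← smul_eq_mul, ← Matrix.smul_apply, ← map_smul]
    refine congrFun (congrFun (congrArg L ?_) _) _
    ext ⟨⟨a, a'⟩, b, b'⟩ ⟨⟨a₂, a₂'⟩, b₂, b₂'⟩
    simp [joint, mul_assoc]
  rw [avgFidelity_standardTeleport hd0] at h
  rw [teleportFidelity_eq hd]
  have ht : (L (joint ρ (α ⊗ₖ β))).trace.re = 1 := by
    rw [hΛ.trace_apply]
    rw [trace_joint, Matrix.trace_kronecker, hρ.1.2, hα.2, hβ.2]
    simp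
  rwa [ht] at h

/-- `f_d(ρ ⊗ π, Λ)` is affine in `π`. -/
lemma exists_linear_teleportFidelity {d : ℕ} (hd : 2 ≤ d) (ρ : Op (A × B))
    {Λ : Op ((A × A') × (B × B')) → Op (Fin d × Fin d)} (hΛ : IsLOCC Λ) :
    ∃ g : Op (A' × B') →ₗ[ℝ] ℝ, ∀ π, teleportFidelity d (joint ρ π) Λ = g π + 1 / (d + 1) := by
  obtain ⟨L, rfl⟩ := hΛ.exists_linearMap
  refine ⟨⟨⟨fun π => (L (joint ρ π) * unnormEnt d).trace.re / (d + 1), fun π π' => ?_⟩,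
    fun c π => ?_⟩, fun π => ?_⟩
  · have : joint ρ (π + π') = joint ρ π + joint ρ π' := by
      simp [joint, Matrix.kronecker_add, Matrix.submatrix_add]
    rw [this, map_add, Matrix.add_mul, Matrix.trace_add, Complex.add_re, add_div]
  · have : joint ρ (c • π) = (c : ℂ) • joint ρ π := by
      ext x y
      simp [joint]
      ring
    simp only [this, map_smul, Matrix.smul_mul, Matrix.trace_smul]
    simp [mul_div_assoc]
  · rw [teleportFidelity_eq hd, add_div]; rfl

theorem teleportFidelity_le_of_sep {d : ℕ} (hd : 2 ≤ d) {ρ : Op (A × B)}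
    (hρ : ρ ∈ Useless d A B) {Λ : Op ((A × A') × (B × B')) → Op (Fin d × Fin d)} (hΛ : IsLOCC Λ)
    {π : Op (A' × B')} (hπ : π ∈ Sep A' B') :
    teleportFidelity d (joint ρ π) Λ ≤ fClass d := by
  obtain ⟨g, hg⟩ := exists_linear_teleportFidelity hd ρ hΛ
  have hconv : Convex ℝ {π : Op (A' × B') | g π ≤ fClass d - 1 / (d + 1)} :=
    convex_halfSpace_le g.isLinear _
  have := convexHull_min (s := {τ : Op (A' × B') | ∃ (α : Op A') (β : Op B'),
    IsState α ∧ IsState β ∧ τ = α ⊗ₖ β}) (fun τ hτ => by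
      obtain ⟨α, β, hα, hβ, rfl⟩ := hτ
      have := teleportFidelity_le_of_product hd hρ hΛ hα hβ
      rw [hg] at this
      exact le_sub_iff_add_le.2 this) hconv hπ
  rw [hg]
  exact le_sub_iff_add_le.1 this

lemma bddAbove_spread {d : ℕ} (hd : 2 ≤ d) {ρ : Op (A × B)} (hρ : IsState ρ)
    {Λ : Op ((A × A') × (B × B')) → Op (Fin d × Fin d)} (hΛ : IsLOCC Λ) :
    BddAbove {x | ∃ π ∈ Sep A' B', x = fClass d - teleportFidelity d (joint ρ π) Λ} := by
  refine ⟨fClass d, ?_⟩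
  rintro x ⟨π, hπ, rfl⟩
  have h : (joint ρ π).PosSemidef :=
    (hρ.1.kronecker (isState_of_mem_sep hπ).1).submatrix _
  have := trace_mul_nonneg (hΛ.posSemidef h) (unnormEnt_posSemidef d)
  rw [teleportFidelity_eq hd]
  have : 0 ≤ ((Λ (joint ρ π) * unnormEnt d).trace.re + 1) / ((d : ℝ) + 1) := by positivity
  linarith

/-- The deficit is affine and nonnegative on separable states, in particular on the mixture
`(σ + s π) / (1 + s)`. -/
theorem activationCapacity_le_robustness {d : ℕ} (hd : 2 ≤ d) (σ : Op (A' × B')) :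
    activationCapacity d σ ≤ robustness σ := by
  refine sSup_le ?_
  rintro x ⟨k, l, ρ, Λ, hρ, hΛ, hne, rfl⟩
  refine le_iInf₂ fun π hπ => le_iInf fun s => le_iInf₂ fun hs hsep => ?_
  rw [EReal.coe_le_coe_iff]
  obtain ⟨g, hg⟩ := exists_linear_teleportFidelity hd ρ hΛ
  have h1 := teleportFidelity_le_of_sep hd hρ hΛ hsep
  have hbdd := bddAbove_spread (A' := A') (B' := B') hd hρ.1 hΛ
  have h2 : fClass d - teleportFidelity d (joint ρ π) Λ ≤ spread d ρ Λ :=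
    le_csSup hbdd ⟨π, hπ, rfl⟩
  have h3 := teleportFidelity_le_of_sep hd hρ hΛ hπ
  have hpos : 0 < spread d ρ Λ := lt_of_le_of_ne (by linarith) hne.symm
  rw [div_le_iff₀ hpos]
  rw [hg] at h1 h2 h3 ⊢
  rw [map_add, map_smul, map_smul, smul_eq_mul, smul_eq_mul] at h1
  have hs1 : 0 < 1 + s := by linarith
  have h4 : g σ + s * g π ≤ (1 + s) * (fClass d - 1 / (d + 1)) := by
    have := mul_le_mul_of_nonneg_left (le_sub_iff_add_le.2 h1) hs1.le
    calc g σ + s * g π = (1 + s) * (1 / (1 + s) * g σ + s / (1 + s) * g π) := by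
          field_simp
      _ ≤ _ := this
  nlinarith [mul_le_mul_of_nonneg_left h2 hs]

end

/-! ### The sesquilinear form of a partially transposed witness -/

/-- The form `⟨f, V^Γ e⟩` of the partial transpose `V^Γ` of `V` in the first factor. Vectors of
`ℂ^a ⊗ ℂ^b` are written as functions of two arguments. -/
def ptForm {a b : Type} [Fintype a] [Fintype b] (V : Op (a × b)) (e f : a → b → ℂ) : ℂ :=
  ∑ s, ∑ t, V s t * (e s.1 t.2 * star (f t.1 s.2))

section
variable {a b : Type} [Fintype a] [Fintype b] (V : Op (a × b))

lemma ptForm_add_add (e f : a → b → ℂ) :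
    ptForm V (fun x y => e x y + f x y) (fun x y => e x y + f x y) =
      ptForm V e e + ptForm V e f + ptForm V f e + ptForm V f f := by
  simp only [ptForm, ← Finset.sum_add_distrib]
  refine Finset.sum_congr rfl fun s _ => Finset.sum_congr rfl fun t _ => ?_
  rw [star_add]
  ring

lemma ptForm_smul_smul (c : ℂ) (e : a → b → ℂ) :
    (ptForm V (fun x y => e x y * c) fun x y => e x y * c).re = ‖c‖ ^ 2 * (ptForm V e e).re := by
  have : ptForm V (fun x y => e x y * c) (fun x y => e x y * c) =
      ((‖c‖ ^ 2 : ℝ) : ℂ) * ptForm V e e := by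
    simp only [ptForm, Finset.mul_sum]
    refine Finset.sum_congr rfl fun s _ => Finset.sum_congr rfl fun t _ => ?_
    have h : c * star c = ((‖c‖ ^ 2 : ℝ) : ℂ) := by
      rw [Complex.star_def, Complex.mul_conj, Complex.normSq_eq_norm_sq]
    rw [star_mul', ← h]
    ring
  rw [this, Complex.re_ofReal_mul]

lemma norm_ptForm_le {e f : a → b → ℂ} {p q : ℝ} (hp : 0 ≤ p) (he : ∀ x y, ‖e x y‖ ≤ p)
    (hf : ∀ x y, ‖f x y‖ ≤ q) : ‖ptForm V e f‖ ≤ (∑ s, ∑ t, ‖V s t‖) * (p * q) := by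
  rw [Finset.sum_mul]
  refine (norm_sum_le _ _).trans (Finset.sum_le_sum fun s _ => ?_)
  rw [Finset.sum_mul]
  refine (norm_sum_le _ _).trans (Finset.sum_le_sum fun t _ => ?_)
  rw [norm_mul, norm_mul, norm_star]
  exact mul_le_mul_of_nonneg_left (mul_le_mul (he _ _) (hf _ _) (norm_nonneg _) hp) (norm_nonneg _)

/-- If the form is strictly positive on product vectors, then it is almost nonnegative on vectors
`e` which are almost product, in the sense that the rank one condition
`e x y * e x₀ y₀ = u x * v y` holds up to an error controlled by `r`. The proof applies the
condition at an entry `e x₀ y₀` of maximal modulus `m`. For `m ≤ r` the form is trivially of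
order `r ^ 2`. Otherwise the error is at most `4 * r * m`, and completing the square absorbs the
cross terms into the strictly positive term. -/
lemma ptForm_lower_bound {ε : ℝ} (hε : 0 < ε)
    (hV : ∀ (u : a → ℂ) (v : b → ℂ),
      ε * ((∑ x, ‖u x‖ ^ 2) * ∑ y, ‖v y‖ ^ 2) ≤
        (ptForm V (fun x y => u x * v y) fun x y => u x * v y).re) :
    ∃ K : ℝ, 0 ≤ K ∧ ∀ (e : a → b → ℂ) (r : ℝ), 0 ≤ r →
      (∀ (m : ℝ) (x₀ : a) (y₀ : b), (∀ x y, ‖e x y‖ ≤ m) → ∃ (u : a → ℂ) (v : b → ℂ),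
        ∀ x y, ‖e x y * e x₀ y₀ - u x * v y‖ ≤ 2 * r * (m + r)) →
      -(K * r ^ 2) ≤ (ptForm V e e).re := by
  set S : ℝ := ∑ s, ∑ t, ‖V s t‖ with hS
  have hS0 : 0 ≤ S := Finset.sum_nonneg fun _ _ => Finset.sum_nonneg fun _ _ => norm_nonneg _
  refine ⟨16 * S ^ 2 / ε + 16 * S, by positivity, fun e r hr h => ?_⟩
  have hK : S ≤ 16 * S ^ 2 / ε + 16 * S := by
    have : 0 ≤ 16 * S ^ 2 / ε := by positivity
    linarith
  rcases isEmpty_or_nonempty (a × b) with hemp | hne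
  · have : ptForm V e e = 0 := by simp [ptForm]
    rw [this, Complex.zero_re, neg_nonpos]
    positivity
  obtain ⟨⟨x₀, y₀⟩, hmax⟩ := Finite.exists_max fun z : a × b => ‖e z.1 z.2‖
  set m := ‖e x₀ y₀‖ with hm
  have hm0 : 0 ≤ m := norm_nonneg _
  have hem : ∀ x y, ‖e x y‖ ≤ m := fun x y => hmax (x, y)
  rcases le_or_gt m r with hmr | hrm
  · have h1 := norm_ptForm_le V hm0 hem hem
    have h2 := (abs_le.1 (Complex.abs_re_le_norm (ptForm V e e))).1
    have h3 : m * m ≤ r ^ 2 := by nlinarith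
    have h4 : S * (m * m) ≤ (16 * S ^ 2 / ε + 16 * S) * r ^ 2 :=
      mul_le_mul hK h3 (by positivity) (hS0.trans hK)
    linarith
  · obtain ⟨u, v, huv⟩ := h m x₀ y₀ hem
    have hmpos : 0 < m := hr.trans_lt hrm
    set E : a → b → ℂ := fun x y => e x y * e x₀ y₀ - u x * v y with hE
    have hEb : ∀ x y, ‖E x y‖ ≤ 4 * r * m := fun x y =>
      (huv x y).trans (by nlinarith)
    set p : ℝ := Real.sqrt ((∑ x, ‖u x‖ ^ 2) * ∑ y, ‖v y‖ ^ 2) with hp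
    have hpp : p ^ 2 = (∑ x, ‖u x‖ ^ 2) * ∑ y, ‖v y‖ ^ 2 := Real.sq_sqrt (by positivity)
    have hp0 : 0 ≤ p := Real.sqrt_nonneg _
    have hPb : ∀ x y, ‖u x * v y‖ ≤ p := by
      intro x y
      apply Real.le_sqrt_of_sq_le
      rw [norm_mul, mul_pow]
      exact mul_le_mul (Finset.single_le_sum (f := fun x => ‖u x‖ ^ 2)
        (fun _ _ => by positivity) (Finset.mem_univ x))
        (Finset.single_le_sum (f := fun y => ‖v y‖ ^ 2)
        (fun _ _ => by positivity) (Finset.mem_univ y)) (by positivity) (by positivity)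
    have hexp := ptForm_smul_smul V (e x₀ y₀) e
    have hsum : (fun x y => e x y * e x₀ y₀) = fun x y => u x * v y + E x y := by
      ext x y; simp [hE]
    rw [hsum, ptForm_add_add, Complex.add_re, Complex.add_re, Complex.add_re, ← hm] at hexp
    have h1 := (abs_le.1 ((Complex.abs_re_le_norm _).trans (norm_ptForm_le V hp0 hPb hEb))).1
    have h2 := (abs_le.1 ((Complex.abs_re_le_norm _).trans
      (norm_ptForm_le V (by positivity) hEb hPb))).1
    have h3 := (abs_le.1 ((Complex.abs_re_le_norm _).trans
      (norm_ptForm_le V (by positivity) hEb hEb))).1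
    have h4 := hV u v
    rw [← hpp] at h4
    rw [← hS] at h1 h2 h3
    -- The error terms cost `8 S r m p` and `16 S r² m²`, against the gain `ε p²`.
    have hmul : -((16 * S ^ 2 / ε + 16 * S) * r ^ 2) * m ^ 2 ≤ m ^ 2 * (ptForm V e e).re := by
      rw [← hexp]
      have hsq : 0 ≤ (ε * p - 4 * S * r * m) ^ 2 / ε := by positivity
      have : (ε * p - 4 * S * r * m) ^ 2 / ε =
          ε * p ^ 2 - 8 * S * r * m * p + 16 * S ^ 2 / ε * r ^ 2 * m ^ 2 := by
        field_simp
        ring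
      nlinarith
    have hm2 : 0 < m ^ 2 := by positivity
    rw [mul_comm (m ^ 2)] at hmul
    exact le_of_mul_le_mul_right hmul hm2

/-- The key inequality for two rows, told apart by the prime, and two columns `1` and `2`. With
`x_k ∧ y_l` for `x_k ⊗ y_l' - x_k' ⊗ y_l`, the vectors `e` and `q` are the differences and sums of
`x₁ ∧ y₂` and `x₂ ∧ y₁`, while `q₁` and `q₂` are the doubles of `x₁ ∧ y₁` and `x₂ ∧ y₂`. By a
Plücker type identity `e` is a product vector up to terms that contain `q`, `q₁` or `q₂`. -/
lemma ptForm_block {ε : ℝ} (hε : 0 < ε)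
    (hV : ∀ (u : a → ℂ) (v : b → ℂ),
      ε * ((∑ x, ‖u x‖ ^ 2) * ∑ y, ‖v y‖ ^ 2) ≤
        (ptForm V (fun x y => u x * v y) fun x y => u x * v y).re) :
    ∃ K : ℝ, 0 ≤ K ∧ ∀ (x₁ x₁' x₂ x₂' : a → ℂ) (y₁ y₁' y₂ y₂' : b → ℂ)
      (e q q₁ q₂ : a → b → ℂ),
      (∀ α β, e α β = x₁ α * y₂' β - x₁' α * y₂ β - (x₂ α * y₁' β - x₂' α * y₁ β)) →
      (∀ α β, q α β = x₁ α * y₂' β - x₁' α * y₂ β + (x₂ α * y₁' β - x₂' α * y₁ β)) →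
      (∀ α β, q₁ α β = x₁ α * y₁' β - x₁' α * y₁ β + (x₁ α * y₁' β - x₁' α * y₁ β)) →
      (∀ α β, q₂ α β = x₂ α * y₂' β - x₂' α * y₂ β + (x₂ α * y₂' β - x₂' α * y₂ β)) →
      -(K * ((∑ α, ∑ β, ‖q α β‖ ^ 2) + (∑ α, ∑ β, ‖q₁ α β‖ ^ 2) + ∑ α, ∑ β, ‖q₂ α β‖ ^ 2)) ≤
        (ptForm V e e).re := by
  obtain ⟨K, hK, h⟩ := ptForm_lower_bound V hε hV
  refine ⟨K, hK, fun x₁ x₁' x₂ x₂' y₁ y₁' y₂ y₂' e q q₁ q₂ he hq hq₁ hq₂ => ?_⟩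
  set R := (∑ α, ∑ β, ‖q α β‖ ^ 2) + (∑ α, ∑ β, ‖q₁ α β‖ ^ 2) + ∑ α, ∑ β, ‖q₂ α β‖ ^ 2 with hR
  have hnn : ∀ f : a → b → ℂ, 0 ≤ ∑ α, ∑ β, ‖f α β‖ ^ 2 := fun f =>
    Finset.sum_nonneg fun _ _ => Finset.sum_nonneg fun _ _ => by positivity
  have hle : ∀ (f : a → b → ℂ) α β, ‖f α β‖ ^ 2 ≤ ∑ α, ∑ β, ‖f α β‖ ^ 2 := fun f α β =>
    (Finset.single_le_sum (f := fun β => ‖f α β‖ ^ 2) (fun _ _ => by positivity)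
      (Finset.mem_univ β)).trans (Finset.single_le_sum (f := fun α => ∑ β, ‖f α β‖ ^ 2)
      (fun _ _ => Finset.sum_nonneg fun _ _ => by positivity) (Finset.mem_univ α))
  have hR0 : 0 ≤ R := by
    have := hnn q; have := hnn q₁; have := hnn q₂; linarith
  have hb : ∀ α β, ‖q α β‖ ≤ Real.sqrt R := fun α β => Real.le_sqrt_of_sq_le <| by
    have := hle q α β; have := hnn q₁; have := hnn q₂; linarith
  have hb₁ : ∀ α β, ‖q₁ α β‖ ≤ Real.sqrt R := fun α β => Real.le_sqrt_of_sq_le <| by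
    have := hle q₁ α β; have := hnn q; have := hnn q₂; linarith
  have hb₂ : ∀ α β, ‖q₂ α β‖ ≤ Real.sqrt R := fun α β => Real.le_sqrt_of_sq_le <| by
    have := hle q₂ α β; have := hnn q; have := hnn q₁; linarith
  have hr := Real.sqrt_nonneg R
  rw [← Real.sq_sqrt hR0]
  refine h e _ hr fun m α₀ β₀ hm => ?_
  refine ⟨fun α => x₁ α * x₂' α₀ - x₁' α * x₂ α₀, fun β => 4 * (y₁ β₀ * y₂' β - y₁' β₀ * y₂ β),
    fun α β => ?_⟩
  -- The Plücker type identity: every term on the right contains a symmetric part.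
  have key : e α β * e α₀ β₀ -
      (x₁ α * x₂' α₀ - x₁' α * x₂ α₀) * (4 * (y₁ β₀ * y₂' β - y₁' β₀ * y₂ β)) =
      (e α β * q α₀ β₀ - q α β * e α₀ β₀) + (q α β * q α₀ β₀ - q₁ α β₀ * q₂ α₀ β) := by
    rw [he, he, hq, hq, hq₁, hq₂]
    ring
  rw [key]
  have hm0 : 0 ≤ m := (norm_nonneg _).trans (hm α β)
  have t1 : ‖e α β * q α₀ β₀‖ ≤ m * Real.sqrt R := by
    rw [norm_mul]; exact mul_le_mul (hm _ _) (hb _ _) (norm_nonneg _) hm0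
  have t2 : ‖q α β * e α₀ β₀‖ ≤ Real.sqrt R * m := by
    rw [norm_mul]; exact mul_le_mul (hb _ _) (hm _ _) (norm_nonneg _) hr
  have t3 : ‖q α β * q α₀ β₀‖ ≤ Real.sqrt R * Real.sqrt R := by
    rw [norm_mul]; exact mul_le_mul (hb _ _) (hb _ _) (norm_nonneg _) hr
  have t4 : ‖q₁ α β₀ * q₂ α₀ β‖ ≤ Real.sqrt R * Real.sqrt R := by
    rw [norm_mul]; exact mul_le_mul (hb₁ _ _) (hb₂ _ _) (norm_nonneg _) hr
  have s1 := norm_sub_le (e α β * q α₀ β₀) (q α β * e α₀ β₀)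
  have s2 := norm_sub_le (q α β * q α₀ β₀) (q₁ α β₀ * q₂ α₀ β)
  have s3 := norm_add_le (e α β * q α₀ β₀ - q α β * e α₀ β₀)
    (q α β * q α₀ β₀ - q₁ α β₀ * q₂ α₀ β)
  nlinarith

end

/-! ### Local filterings of the states built from a witness -/

/-- Antisymmetrization in the first two and symmetrization (`c = 1`) or antisymmetrization
(`c = -1`) in the last two indices, without normalization. -/
def symmetrizer {d : ℕ} (c : ℂ) (P : Fin d → Fin d → Fin d → Fin d → ℂ) (i j k l : Fin d) : ℂ :=
  P i j k l - P j i k l + c * (P i j l k - P j i l k)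

/-- A quarter of the symmetrizer is an orthogonal projection. -/
lemma sum_mul_star_symmetrizer {d : ℕ} {c : ℂ} (hc : c = 1 ∨ c = -1)
    (P Q : Fin d → Fin d → Fin d → Fin d → ℂ) :
    ∑ i, ∑ j, ∑ k, ∑ l, P i j k l * star (symmetrizer c Q i j k l) =
      (1 / 4) * ∑ i, ∑ j, ∑ k, ∑ l, symmetrizer c P i j k l * star (symmetrizer c Q i j k l) := by
  have hcc : c * c = 1 := by rcases hc with rfl | rfl <;> norm_num
  have hcs : star c = c := by rcases hc with rfl | rfl <;> simp
  set T := ∑ i, ∑ j, ∑ k, ∑ l, P i j k l * star (symmetrizer c Q i j k l) with hT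
  have h1 : ∑ i, ∑ j, ∑ k, ∑ l, P j i k l * star (symmetrizer c Q i j k l) = -T := by
    rw [Finset.sum_comm, hT]
    simp only [← Finset.sum_neg_distrib]
    refine Finset.sum_congr rfl fun i _ => Finset.sum_congr rfl fun j _ =>
      Finset.sum_congr rfl fun k _ => Finset.sum_congr rfl fun l _ => ?_
    rw [← mul_neg, ← star_neg]
    congr 2
    simp only [symmetrizer]; ring
  have h2 : ∑ i, ∑ j, ∑ k, ∑ l, P i j l k * star (symmetrizer c Q i j k l) = c * T := by
    rw [hT]
    simp only [Finset.mul_sum]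
    refine Finset.sum_congr rfl fun i _ => Finset.sum_congr rfl fun j _ => ?_
    rw [Finset.sum_comm]
    refine Finset.sum_congr rfl fun k _ => Finset.sum_congr rfl fun l _ => ?_
    rw [← mul_assoc, mul_comm c, mul_assoc]
    congr 1
    have hs : ∀ z : ℂ, c * star z = star (c * z) := fun z => by rw [star_mul', hcs]
    rw [hs]
    congr 1
    simp only [symmetrizer]
    linear_combination (-(Q i j l k) + Q j i l k) * hcc
  have h3 : ∑ i, ∑ j, ∑ k, ∑ l, P j i l k * star (symmetrizer c Q i j k l) = -(c * T) := by
    rw [← h2, Finset.sum_comm]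
    simp only [← Finset.sum_neg_distrib]
    refine Finset.sum_congr rfl fun i _ => Finset.sum_congr rfl fun j _ =>
      Finset.sum_congr rfl fun k _ => Finset.sum_congr rfl fun l _ => ?_
    rw [← mul_neg, ← star_neg]
    congr 2
    simp only [symmetrizer]; ring
  have h4 : ∑ i, ∑ j, ∑ k, ∑ l, symmetrizer c P i j k l * star (symmetrizer c Q i j k l) =
      T - (-T) + c * (c * T - (-(c * T))) := by
    rw [← h1, ← h3, ← h2, hT]
    simp only [← Finset.sum_sub_distrib, Finset.mul_sum, ← Finset.sum_add_distrib]
    refine Finset.sum_congr rfl fun i _ => Finset.sum_congr rfl fun j _ =>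
      Finset.sum_congr rfl fun k _ => Finset.sum_congr rfl fun l _ => ?_
    rw [symmetrizer]
    ring
  rw [h4]
  linear_combination (-1 / 2) * T * hcc


section
variable {d : ℕ} {a b : Type} [Fintype a] [Fintype b]

lemma sum_joint_index (f : (a × Fin d) × (b × Fin d) → ℂ) :
    ∑ x, f x = ∑ s : a × b, ∑ g : Fin d × Fin d, f ((s.1, g.1), (s.2, g.2)) := by
  rw [← (Equiv.prodProdProdComm a b (Fin d) (Fin d)).sum_comp, Fintype.sum_prod_type]
  rfl

lemma filter_joint_apply (K : Matrix (Fin d) (a × Fin d) ℂ) (L : Matrix (Fin d) (b × Fin d) ℂ)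
    (T : Op (a × b)) (R : Op (Fin d × Fin d)) (p p' : Fin d × Fin d) :
    ((K ⊗ₖ L) * joint T R * (K ⊗ₖ L)ᴴ) p p' = ∑ s, ∑ t, T s t * ∑ g, ∑ h, R g h *
      (K p.1 (s.1, g.1) * L p.2 (s.2, g.2) * (star (K p'.1 (t.1, h.1)) *
        star (L p'.2 (t.2, h.2)))) := by
  simp only [Matrix.mul_apply, Finset.sum_mul, sum_joint_index, Finset.mul_sum]
  conv_rhs => rw [Finset.sum_comm]
  refine Finset.sum_congr rfl fun t _ => ?_
  rw [Finset.sum_comm]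
  refine Finset.sum_congr rfl fun s _ => ?_
  rw [Finset.sum_comm]
  refine Finset.sum_congr rfl fun g _ => Finset.sum_congr rfl fun h _ => ?_
  simp only [joint, Matrix.kroneckerMap_apply, Matrix.submatrix_apply,
    Matrix.conjTranspose_apply, Equiv.prodProdProdComm_apply, star_mul']
  ring

lemma sum_one_add_smul_unnormEnt (c : ℂ) (F : Fin d × Fin d → Fin d × Fin d → ℂ) :
    ∑ g, ∑ h, (1 + c • unnormEnt d) g h * F g h =
      ∑ k, ∑ l, (F (k, l) (k, l) + c * F (k, k) (l, l)) := by
  simp only [Matrix.add_apply, add_mul, Finset.sum_add_distrib]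
  congr 1
  · simp only [Matrix.one_apply, ite_mul, one_mul, zero_mul, Finset.sum_ite_eq, Finset.mem_univ,
      if_true, Fintype.sum_prod_type]
  · simp only [Fintype.sum_prod_type, Matrix.smul_apply, unnormEnt, Matrix.of_apply, smul_eq_mul]
    refine Finset.sum_congr rfl fun k _ => ?_
    rw [Finset.sum_eq_single k (fun l _ hl => by simp [hl.symm]) (by simp)]
    refine Finset.sum_congr rfl fun l _ => ?_
    rw [Finset.sum_eq_single l (fun k _ hl => by simp [hl.symm]) (by simp)]
    simp

/-- The overlap of a filtered state with `1 - d φ_d`, in terms of the partial transpose. The latter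
turns `d φ_d` into the swap, hence `1 - d φ_d` and `1 + c d φ_d` into multiples of projectors on
antisymmetric and on symmetric (`c = 1`) or antisymmetric (`c = -1`) vectors. -/
lemma trace_filter_joint (K : Matrix (Fin d) (a × Fin d) ℂ) (L : Matrix (Fin d) (b × Fin d) ℂ)
    (T : Op (a × b)) {c : ℂ} (hc : c = 1 ∨ c = -1) :
    ((K ⊗ₖ L) * joint T (1 + c • unnormEnt d) * (K ⊗ₖ L)ᴴ * (1 - unnormEnt d)).trace =
      (1 / 4) * ∑ i, ∑ j, ∑ k, ∑ l,
        ptForm T (fun x y => symmetrizer c (fun i j k l => K i (x, k) * star (L j (y, l))) i j k l)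
          (fun x y => symmetrizer c (fun i j k l => K i (x, k) * star (L j (y, l))) i j k l) := by
  have hcs : star c = c := by rcases hc with rfl | rfl <;> simp
  rw [Matrix.mul_sub, Matrix.mul_one, Matrix.trace_sub, trace_mul_unnormEnt]
  have htr : ∀ M : Op (Fin d × Fin d), M.trace = ∑ i, ∑ j, M (i, j) (i, j) := fun M => by
    simp [Matrix.trace, Fintype.sum_prod_type]
  rw [htr]
  simp only [filter_joint_apply, sum_one_add_smul_unnormEnt]
  simp only [← Finset.sum_sub_distrib, ← mul_sub]
  have hcomm : ∀ G : Fin d → Fin d → a × b → a × b → ℂ,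
      ∑ i, ∑ j, ∑ s, ∑ t, G i j s t = ∑ s, ∑ t, ∑ i, ∑ j, G i j s t := by
    intro G
    calc _ = ∑ i, ∑ s, ∑ t, ∑ j, G i j s t := Finset.sum_congr rfl fun i _ => by
          rw [Finset.sum_comm]
          exact Finset.sum_congr rfl fun s _ => Finset.sum_comm
      _ = _ := by
          rw [Finset.sum_comm]
          exact Finset.sum_congr rfl fun s _ => Finset.sum_comm
  have hr : ∑ i, ∑ j, ∑ k, ∑ l,
        ptForm T (fun x y => symmetrizer c (fun i j k l => K i (x, k) * star (L j (y, l))) i j k l)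
          (fun x y => symmetrizer c (fun i j k l => K i (x, k) * star (L j (y, l))) i j k l) =
      ∑ s, ∑ t, ∑ i, ∑ j, ∑ k, ∑ l, T s t *
        (symmetrizer c (fun i j k l => K i (s.1, k) * star (L j (t.2, l))) i j k l *
        star (symmetrizer c (fun i j k l => K i (t.1, k) * star (L j (s.2, l))) i j k l)) := by
    rw [← hcomm]
    exact Finset.sum_congr rfl fun i _ => Finset.sum_congr rfl fun j _ => hcomm _
  rw [hr]
  refine (hcomm _).trans ?_
  rw [Finset.mul_sum]
  refine Finset.sum_congr rfl fun s _ => ?_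
  rw [Finset.mul_sum]
  refine Finset.sum_congr rfl fun t _ => ?_
  simp only [← Finset.mul_sum]
  rw [mul_left_comm, ← sum_mul_star_symmetrizer hc]
  refine congrArg (T s t * ·) ?_
  refine Finset.sum_congr rfl fun i _ => Finset.sum_congr rfl fun j _ =>
    Finset.sum_congr rfl fun k _ => Finset.sum_congr rfl fun l _ => ?_
  simp only [symmetrizer, star_add, star_sub, star_mul', star_star, hcs]
  ring

end

/-! ### Useless states built from a witness -/

open scoped MatrixOrder Matrix.Norms.L2Operator in
lemma exists_smul_one_add_sub_posSemidef {n : Type} [Fintype n] [DecidableEq n] {V : Op n}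
    (hV : V.IsHermitian) (κ₀ : ℝ) : ∃ κ : ℝ, κ₀ ≤ κ ∧ 0 < κ ∧
      (((κ : ℂ) • (1 : Op n) + V).PosSemidef ∧ ((κ : ℂ) • (1 : Op n) - V).PosSemidef) := by
  have hsa : IsSelfAdjoint V := hV
  have h1 : V ≤ algebraMap ℝ (Op n) ‖V‖ := hsa.le_algebraMap_norm_self
  have h2 : -V ≤ algebraMap ℝ (Op n) ‖V‖ := by
    have := hsa.neg.le_algebraMap_norm_self
    rwa [norm_neg] at this
  have halg : algebraMap ℝ (Op n) ‖V‖ = ((‖V‖ : ℝ) : ℂ) • (1 : Op n) := by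
    rw [Algebra.algebraMap_eq_smul_one]; ext i j; simp
  have h3 : ∀ W : Op n, W ≤ algebraMap ℝ (Op n) ‖V‖ → ∀ κ : ℝ, ‖V‖ ≤ κ →
      ((κ : ℂ) • (1 : Op n) - W).PosSemidef := by
    intro W hW κ hκ
    rw [halg] at hW
    have h5 : (((κ - ‖V‖ : ℝ) : ℂ) • (1 : Op n)).PosSemidef :=
      Matrix.PosSemidef.one.smul (by exact_mod_cast sub_nonneg.2 hκ)
    have h6 := (Matrix.le_iff.1 hW).add h5
    have h7 : (κ : ℂ) • (1 : Op n) - W =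
        ((‖V‖ : ℝ) : ℂ) • (1 : Op n) - W + ((κ - ‖V‖ : ℝ) : ℂ) • (1 : Op n) := by
      push_cast
      rw [sub_smul]
      abel
    rw [h7]
    exact h6
  refine ⟨max (max κ₀ 1) ‖V‖, (le_max_left _ _).trans (le_max_left _ _),
    lt_of_lt_of_le one_pos ((le_max_right _ _).trans (le_max_left _ _)), ?_, ?_⟩
  · have := h3 (-V) h2 _ (le_max_right (max κ₀ 1) ‖V‖)
    rwa [sub_neg_eq_add] at this
  · exact h3 V h1 _ (le_max_right _ _)

/-- The unnormalized state `κ 1 ⊗ (1 + d φ_d) + V ⊗ (1 - d φ_d)` built from a witness `V`. It is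
written as `(κ 1 + V) ⊗ 1 + (κ 1 - V) ⊗ d φ_d`, which is positive semidefinite for large `κ`. -/
def witnessOp {a b : Type} [DecidableEq a] [DecidableEq b] (d : ℕ) (κ : ℝ) (V : Op (a × b)) :
    Op ((a × Fin d) × (b × Fin d)) :=
  joint ((κ : ℂ) • 1 + V) 1 + joint ((κ : ℂ) • 1 - V) (unnormEnt d)

lemma witnessOp_eq {d : ℕ} {a b : Type} [DecidableEq a] [DecidableEq b] (κ : ℝ)
    (V : Op (a × b)) : witnessOp d κ V =
    (κ : ℂ) • joint 1 (1 + (1 : ℂ) • unnormEnt d) + joint V (1 + (-1 : ℂ) • unnormEnt d) := by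
  ext x y
  simp only [witnessOp, joint, Matrix.add_apply, Matrix.smul_apply, Matrix.submatrix_apply,
    Matrix.kroneckerMap_apply, Matrix.sub_apply, smul_eq_mul]
  ring

section
variable {d : ℕ} {a b : Type} [Fintype a] [DecidableEq a] [Fintype b] [DecidableEq b]

lemma ptForm_one (e : a → b → ℂ) : ptForm 1 e e = ((∑ x, ∑ y, ‖e x y‖ ^ 2 : ℝ) : ℂ) := by
  simp only [ptForm, Matrix.one_apply, ite_mul, one_mul, zero_mul, Finset.sum_ite_eq,
    Finset.mem_univ, if_true, Fintype.sum_prod_type]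
  push_cast
  refine Finset.sum_congr rfl fun x _ => Finset.sum_congr rfl fun y _ => ?_
  rw [Complex.star_def, Complex.mul_conj, Complex.normSq_eq_norm_sq]
  push_cast
  rfl

/-- If `V` is strictly positive on product vectors, then for large `κ` no local filtering of
`witnessOp d κ V` has fidelity with `φ_d` larger than `1 / d`. -/
theorem exists_filter_bound {V : Op (a × b)} {ε : ℝ} (hε : 0 < ε)
    (hV : ∀ (u : a → ℂ) (v : b → ℂ),
      ε * ((∑ x, ‖u x‖ ^ 2) * ∑ y, ‖v y‖ ^ 2) ≤
        (ptForm V (fun x y => u x * v y) fun x y => u x * v y).re) :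
    ∃ κ₀ : ℝ, ∀ κ, κ₀ ≤ κ → ∀ (K : Matrix (Fin d) (a × Fin d) ℂ)
      (L : Matrix (Fin d) (b × Fin d) ℂ),
      0 ≤ ((K ⊗ₖ L) * witnessOp d κ V * (K ⊗ₖ L)ᴴ * (1 - unnormEnt d)).trace.re := by
  obtain ⟨C, hC, hblock⟩ := ptForm_block V hε hV
  -- Each block involves `N i j k l`, `N i j k k` and `N i j l l`; summed over `k` and `l`, the
  -- diagonal ones are counted `d` times each.
  refine ⟨C * (1 + 2 * d), fun κ hκ K L => ?_⟩
  rw [witnessOp_eq, Matrix.mul_add, Matrix.add_mul, Matrix.add_mul, Matrix.trace_add,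
    Matrix.mul_smul, Matrix.smul_mul, Matrix.smul_mul, Matrix.trace_smul,
    trace_filter_joint K L 1 (Or.inl rfl), trace_filter_joint K L V (Or.inr rfl)]
  set P : a → b → Fin d → Fin d → Fin d → Fin d → ℂ :=
    fun x y i j k l => K i (x, k) * star (L j (y, l)) with hP
  set N : Fin d → Fin d → Fin d → Fin d → ℝ :=
    fun i j k l => ∑ x, ∑ y, ‖symmetrizer 1 (P x y) i j k l‖ ^ 2 with hN
  have hN0 : ∀ i j k l, 0 ≤ N i j k l := fun i j k l =>
    Finset.sum_nonneg fun _ _ => Finset.sum_nonneg fun _ _ => by positivity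
  simp only [ptForm_one]
  have h1 : ∀ i j k l, -(C * (N i j k l + N i j k k + N i j l l)) ≤
      (ptForm V (fun x y => symmetrizer (-1) (P x y) i j k l)
        fun x y => symmetrizer (-1) (P x y) i j k l).re := by
    intro i j k l
    refine hblock (fun x => K i (x, k)) (fun x => K j (x, k)) (fun x => K i (x, l))
      (fun x => K j (x, l)) (fun y => star (L i (y, k))) (fun y => star (L j (y, k)))
      (fun y => star (L i (y, l))) (fun y => star (L j (y, l))) _ _ _ _ ?_ ?_ ?_ ?_ <;>
    · intro x y
      simp only [symmetrizer, hP]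
      ring
  have h2 : ∀ i j, ∑ k, ∑ l, (N i j k l + N i j k k + N i j l l) ≤
      (1 + 2 * d) * ∑ k, ∑ l, N i j k l := by
    intro i j
    have hdiag : ∑ k, N i j k k ≤ ∑ k, ∑ l, N i j k l := Finset.sum_le_sum fun k _ =>
      Finset.single_le_sum (f := fun l => N i j k l) (fun l _ => hN0 i j k l) (Finset.mem_univ k)
    simp only [Finset.sum_add_distrib, Finset.sum_const, Finset.card_univ, Fintype.card_fin,
      nsmul_eq_mul, ← Finset.mul_sum]
    have : (0 : ℝ) ≤ d := Nat.cast_nonneg d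
    nlinarith
  have h3 : -(C * (1 + 2 * d)) * ∑ i, ∑ j, ∑ k, ∑ l, N i j k l ≤ ∑ i, ∑ j, ∑ k, ∑ l,
      (ptForm V (fun x y => symmetrizer (-1) (P x y) i j k l)
        fun x y => symmetrizer (-1) (P x y) i j k l).re := by
    rw [Finset.mul_sum]
    refine Finset.sum_le_sum fun i _ => ?_
    rw [Finset.mul_sum]
    refine Finset.sum_le_sum fun j _ => ?_
    calc -(C * (1 + 2 * d)) * ∑ k, ∑ l, N i j k l
        ≤ -C * ∑ k, ∑ l, (N i j k l + N i j k k + N i j l l) := by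
          have := mul_le_mul_of_nonneg_left (h2 i j) hC
          linarith
      _ ≤ _ := by
          rw [Finset.mul_sum]
          refine Finset.sum_le_sum fun k _ => ?_
          rw [Finset.mul_sum]
          refine Finset.sum_le_sum fun l _ => ?_
          rw [neg_mul]
          exact h1 i j k l
  have hq : ((1 / 4 : ℂ)) = ((1 / 4 : ℝ) : ℂ) := by norm_num
  rw [hq, smul_eq_mul, Complex.add_re, Complex.re_ofReal_mul, Complex.re_ofReal_mul,
    Complex.re_ofReal_mul]
  simp only [Complex.re_sum, Complex.ofReal_re]
  have hsum : 0 ≤ ∑ i, ∑ j, ∑ k, ∑ l, N i j k l :=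
    Finset.sum_nonneg fun i _ => Finset.sum_nonneg fun j _ => Finset.sum_nonneg fun k _ =>
      Finset.sum_nonneg fun l _ => hN0 i j k l
  have h4 := mul_le_mul_of_nonneg_right hκ hsum
  change 0 ≤ κ * (1 / 4 * ∑ i, ∑ j, ∑ k, ∑ l, N i j k l) + _
  linarith

/-- Normalized and moved to standard index sets, `witnessOp d κ V` is a useless state for a suitable
`κ`. -/
theorem exists_useless_witnessOp [Nonempty a] [Nonempty b] (hd : 0 < d) {V : Op (a × b)}
    (hVh : V.IsHermitian) {ε : ℝ} (hε : 0 < ε)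
    (hV : ∀ (u : a → ℂ) (v : b → ℂ),
      ε * ((∑ x, ‖u x‖ ^ 2) * ∑ y, ‖v y‖ ^ 2) ≤
        (ptForm V (fun x y => u x * v y) fun x y => u x * v y).re)
    {k l : ℕ} (eA : Fin k ≃ a × Fin d) (eB : Fin l ≃ b × Fin d) :
    ∃ κ N : ℝ, 0 < N ∧
      ((N : ℂ) • (witnessOp d κ V).submatrix (Prod.map eA eB) (Prod.map eA eB)) ∈
        Useless d (Fin k) (Fin l) := by
  obtain ⟨κ₀, hκ₀⟩ := exists_filter_bound (d := d) hε hV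
  obtain ⟨κ, hκ, hκ0, hp, hm⟩ := exists_smul_one_add_sub_posSemidef hVh κ₀
  have hpsd : (witnessOp d κ V).PosSemidef :=
    ((hp.kronecker Matrix.PosSemidef.one).submatrix _).add
      ((hm.kronecker (unnormEnt_posSemidef d)).submatrix _)
  have htr : (witnessOp d κ V).trace = ((κ : ℂ) • (1 : Op (a × b)) + V).trace * (d * d) +
      ((κ : ℂ) • (1 : Op (a × b)) - V).trace * d := by
    rw [witnessOp, Matrix.trace_add, trace_joint, trace_joint, trace_unnormEnt, Matrix.trace_one]
    simp
  have hpt := hp.trace_nonneg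
  have hmt := hm.trace_nonneg
  have hdr : (1 : ℝ) ≤ d := by exact_mod_cast hd
  have htpos : 0 < (witnessOp d κ V).trace.re := by
    have h1 := (Complex.le_def.1 hpt).1
    have h2 := (Complex.le_def.1 hmt).1
    have h3 : (((κ : ℂ) • (1 : Op (a × b)) + V).trace).re +
        (((κ : ℂ) • (1 : Op (a × b)) - V).trace).re = 2 * κ * Fintype.card (a × b) := by
      simp only [Matrix.trace_add, Matrix.trace_sub, Matrix.trace_smul, Matrix.trace_one,
        Complex.add_re, Complex.sub_re, smul_eq_mul, Complex.re_ofReal_mul, Complex.natCast_re]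
      ring
    have h4 : (0 : ℝ) < Fintype.card (a × b) := by exact_mod_cast Fintype.card_pos
    have h5 : 0 < 2 * κ * Fintype.card (a × b) := by positivity
    rw [htr, Complex.add_re, ← Nat.cast_mul, ← Complex.ofReal_natCast, ← Complex.ofReal_natCast,
      Complex.re_mul_ofReal, Complex.re_mul_ofReal]
    rw [Complex.zero_re] at h1 h2
    have h6 := le_mul_of_one_le_right h1 (one_le_mul_of_one_le_of_one_le hdr hdr)
    have h7 := le_mul_of_one_le_right h2 hdr
    push_cast
    linarith
  set t := (witnessOp d κ V).trace.re with ht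
  have htc : (witnessOp d κ V).trace = (t : ℂ) := by
    have := (Complex.le_def.1 hpsd.trace_nonneg).2
    apply Complex.ext <;> simp [ht, ← this]
  refine ⟨κ, t⁻¹, inv_pos.2 htpos, ?_⟩
  set e : Fin k × Fin l ≃ (a × Fin d) × (b × Fin d) := Equiv.prodCongr eA eB with he
  have hee : (Prod.map eA eB : Fin k × Fin l → _) = e := rfl
  rw [hee]
  apply mem_useless_of_filter hd
  · refine ⟨(hpsd.submatrix e).smul (by exact_mod_cast (inv_pos.2 htpos).le), ?_⟩
    have : ((witnessOp d κ V).submatrix e e).trace = (witnessOp d κ V).trace :=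
      e.sum_comp fun x => (witnessOp d κ V).diag x
    rw [Matrix.trace_smul, this, htc, smul_eq_mul, ← Complex.ofReal_mul,
      inv_mul_cancel₀ htpos.ne', Complex.ofReal_one]
  · intro K L
    have hKL : K ⊗ₖ L = ((K.submatrix id eA.symm) ⊗ₖ (L.submatrix id eB.symm)).submatrix id e := by
      ext ⟨i, j⟩ ⟨x, y⟩
      simp [he]
    have h := hκ₀ κ hκ (K.submatrix id eA.symm) (L.submatrix id eB.symm)
    rw [hKL, Matrix.mul_smul, Matrix.smul_mul, Matrix.smul_mul, Matrix.trace_smul, smul_eq_mul,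
      Complex.re_ofReal_mul, Matrix.submatrix_mul_equiv, Matrix.conjTranspose_submatrix,
      Matrix.submatrix_mul_equiv, Matrix.submatrix_id_id]
    exact mul_nonneg (inv_pos.2 htpos).le h

end

/-! ### Local projections with a fixed output on failure -/

/-- The Kraus operators that discard a system and prepare the basis state `c` are normalized. -/
lemma sum_reset {A C : Type} [Fintype A] [DecidableEq A] [Fintype C] [DecidableEq C] (c : C) :
    ∑ a : A, (Matrix.single c a (1 : ℂ))ᴴ * Matrix.single c a (1 : ℂ) = 1 := by
  have : ∀ a : A, (Matrix.single c a (1 : ℂ))ᴴ * Matrix.single c a (1 : ℂ) =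
      Matrix.single a a 1 := fun a => by simp [Matrix.conjTranspose_single]
  simp only [this]
  ext x y
  rw [Matrix.sum_apply]
  by_cases hxy : x = y
  · subst hxy
    simp [Matrix.single_apply]
  · rw [Matrix.one_apply_ne hxy]
    refine Finset.sum_eq_zero fun a _ => ?_
    rw [Matrix.single_apply_of_ne]
    rintro ⟨rfl, h⟩
    exact hxy h

section
variable {A B C D : Type} [Fintype A] [DecidableEq A] [Fintype B] [DecidableEq B]
  [Fintype C] [DecidableEq C] [Fintype D] [DecidableEq D]

/-- Replacing the state by a fixed product basis state is LOCC. -/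
lemma exists_isLOCC_reset (c : C) (e : D) : ∃ Λ : Op (A × B) → Op (C × D), IsLOCC Λ ∧
    ∀ X, ∃ z : ℂ, Λ X = z • Matrix.single (c, e) (c, e) 1 := by
  refine ⟨_, IsLOCC.alice' (fun a : A => Matrix.single c a (1 : ℂ)) (sum_reset c) _ fun _ =>
    IsLOCC.bob' (fun b : B => Matrix.single e b (1 : ℂ)) (sum_reset e) _ fun _ => IsLOCC.done,
    fun X => ⟨∑ a, ∑ b, X (a, b) (a, b), ?_⟩⟩
  simp only [Finset.sum_smul]
  refine Finset.sum_congr rfl fun a _ => Finset.sum_congr rfl fun b _ => ?_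
  have h : ((1 : Op C) ⊗ₖ Matrix.single e b (1 : ℂ)) * (Matrix.single c a (1 : ℂ) ⊗ₖ (1 : Op B)) =
      Matrix.single (c, e) (a, b) 1 := by
    rw [← Matrix.mul_kronecker_mul, Matrix.one_mul, Matrix.mul_one,
      Matrix.single_kronecker_single, mul_one]
  calc _ = (((1 : Op C) ⊗ₖ Matrix.single e b (1 : ℂ)) * (Matrix.single c a (1 : ℂ) ⊗ₖ (1 : Op B))) *
        X * (((1 : Op C) ⊗ₖ Matrix.single e b (1 : ℂ)) *
          (Matrix.single c a (1 : ℂ) ⊗ₖ (1 : Op B)))ᴴ := by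
        rw [Matrix.conjTranspose_mul]
        simp only [Matrix.mul_assoc]
    _ = _ := by
        rw [h, Matrix.conjTranspose_single, Matrix.single_mul_mul_single]
        simp [Matrix.smul_single]

/-- The Kraus operators of a partial isometry `S` whose failure is followed by a reset to the basis
state `c`. -/
lemma sum_project {S : Matrix C A ℂ} (hS : S * Sᴴ = 1) (c : C) :
    ∑ o : Option A, (o.elim S fun a => Matrix.single c a (1 : ℂ) * (1 - Sᴴ * S))ᴴ *
      (o.elim S fun a => Matrix.single c a (1 : ℂ) * (1 - Sᴴ * S)) = 1 := by
  have h1 : (1 - Sᴴ * S)ᴴ = 1 - Sᴴ * S := by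
    rw [Matrix.conjTranspose_sub, Matrix.conjTranspose_mul, Matrix.conjTranspose_conjTranspose,
      Matrix.conjTranspose_one]
  have h2 : (1 - Sᴴ * S) * (1 - Sᴴ * S) = 1 - Sᴴ * S := by
    have : Sᴴ * S * (Sᴴ * S) = Sᴴ * S := by
      rw [Matrix.mul_assoc, ← Matrix.mul_assoc S, hS, Matrix.one_mul]
    simp only [Matrix.mul_sub, Matrix.sub_mul, Matrix.one_mul, Matrix.mul_one, this]
    abel
  have h3 : ∀ a : A, (Matrix.single c a (1 : ℂ) * (1 - Sᴴ * S))ᴴ *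
      (Matrix.single c a (1 : ℂ) * (1 - Sᴴ * S)) = (1 - Sᴴ * S) *
        ((Matrix.single c a (1 : ℂ))ᴴ * Matrix.single c a (1 : ℂ)) * (1 - Sᴴ * S) := fun a => by
    rw [Matrix.conjTranspose_mul, h1]
    simp only [Matrix.mul_assoc]
  rw [Fintype.sum_option]
  simp only [Option.elim, h3]
  rw [← Matrix.sum_mul, ← Matrix.mul_sum, sum_reset, Matrix.mul_one, h2]
  abel

/-- The partial isometries `S`, `T` are measured against their complements. If both succeed the
result is kept, otherwise it is replaced by a basis state. -/
lemma exists_isLOCC_project {S : Matrix C A ℂ} (hS : S * Sᴴ = 1) {T : Matrix D B ℂ}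
    (hT : T * Tᴴ = 1) (c : C) (e : D) : ∃ Λ : Op (A × B) → Op (C × D), IsLOCC Λ ∧
      ∀ X, Λ X = (S ⊗ₖ T) * X * (S ⊗ₖ T)ᴴ +
        (X.trace - ((S ⊗ₖ T) * X * (S ⊗ₖ T)ᴴ).trace) • Matrix.single (c, e) (c, e) 1 := by
  obtain ⟨Φ, hΦ, hΦz⟩ := exists_isLOCC_reset (A := C) (B := B) c e
  obtain ⟨Ψ, hΨ, hΨz⟩ := exists_isLOCC_reset (A := C) (B := D) c e
  have hB := IsLOCC.bob' (A := C) _ (sum_project hT e)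
    (fun (o : Option B) (X : Op (C × D)) => o.elim X fun _ => Ψ X)
    (by rintro (_ | b); exacts [IsLOCC.done, hΨ])
  obtain ⟨Θ, hΘe, hΘ⟩ : ∃ Θ, Θ = _ ∧ IsLOCC Θ := ⟨_, rfl, hB⟩
  have hA := IsLOCC.alice' (B := B) _ (sum_project hS c)
    (fun (o : Option A) (X : Op (C × B)) => o.elim (Θ X) fun _ => Φ X)
    (by rintro (_ | a); exacts [hΘ, hΦ])
  refine ⟨_, hA, fun X => ?_⟩
  -- The coefficient of the basis state need not be computed, since LOCC maps preserve the trace.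
  have htr := hA.trace_apply X
  choose z hz using hΦz
  choose w hw using hΨz
  have hst : (S ⊗ₖ T) * X * (S ⊗ₖ T)ᴴ = ((1 : Op C) ⊗ₖ T) * ((S ⊗ₖ (1 : Op B)) * X *
      (S ⊗ₖ (1 : Op B))ᴴ) * ((1 : Op C) ⊗ₖ T)ᴴ := by
    have : S ⊗ₖ T = ((1 : Op C) ⊗ₖ T) * (S ⊗ₖ (1 : Op B)) := by
      rw [← Matrix.mul_kronecker_mul, Matrix.one_mul, Matrix.mul_one]
    rw [this, Matrix.conjTranspose_mul]
    simp only [Matrix.mul_assoc]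
  simp only [Fintype.sum_option, Option.elim, hΘe, hz, hw, ← Finset.sum_smul, ← hst, add_assoc,
    ← add_smul] at htr ⊢
  rw [Matrix.trace_add, Matrix.trace_smul, Matrix.trace_single_eq_same, smul_eq_mul, mul_one]
    at htr
  rw [← htr, add_sub_cancel_left]

end

/-! ### Contraction of the resource with a witness -/

/-- The matrix `∑ ⟨α, α|` which contracts a system `a` with the first factor of a system
`Fin k ≃ a × Fin d` and leaves the second factor. -/
def contraction {k d : ℕ} {a : Type} [DecidableEq a] (e : Fin k ≃ a × Fin d) :
    Matrix (Fin d) (Fin k × a) ℂ :=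
  Matrix.of fun i u => if u.1 = e.symm (u.2, i) then 1 else 0

section
variable {d k l : ℕ} {a b : Type} [Fintype a] [DecidableEq a] [Fintype b] [DecidableEq b]

lemma sum_contraction_mul (e : Fin k ≃ a × Fin d) (i : Fin d) (F : Fin k × a → ℂ) :
    ∑ u, contraction e i u * F u = ∑ α, F (e.symm (α, i), α) := by
  rw [Fintype.sum_prod_type_right]
  refine Finset.sum_congr rfl fun α _ => ?_
  simp [contraction]

lemma star_contraction {k d : ℕ} {a : Type} [DecidableEq a] (e : Fin k ≃ a × Fin d)
    (i : Fin d) (u : Fin k × a) :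
    star (contraction e i u) = contraction e i u := by
  simp only [contraction, Matrix.of_apply]
  split_ifs <;> simp

lemma contraction_mul_conjTranspose (e : Fin k ≃ a × Fin d) :
    contraction e * (contraction e)ᴴ = (Fintype.card a : ℂ) • (1 : Op (Fin d)) := by
  ext i j
  simp only [Matrix.mul_apply, Matrix.conjTranspose_apply, sum_contraction_mul, star_contraction]
  by_cases h : i = j
  · subst h
    simp [contraction]
  · simp [contraction, h]

/-- Alice and Bob contracting the witness factors of a resource with a state `π` leaves a
combination of the other factors, with weights given by the pairing of the witness with `π`. -/
lemma contraction_joint (eA : Fin k ≃ a × Fin d) (eB : Fin l ≃ b × Fin d)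
    (W : Op ((a × Fin d) × (b × Fin d))) (π : Op (a × b)) (p q : Fin d × Fin d) :
    ((contraction eA ⊗ₖ contraction eB) *
      joint (W.submatrix (Prod.map eA eB) (Prod.map eA eB)) π *
      (contraction eA ⊗ₖ contraction eB)ᴴ) p q =
      ∑ s, ∑ t, W ((s.1, p.1), (s.2, p.2)) ((t.1, q.1), (t.2, q.2)) * π s t := by
  have hsum : ∀ (p : Fin d × Fin d) (F : (Fin k × a) × (Fin l × b) → ℂ),
      ∑ x, (contraction eA ⊗ₖ contraction eB) p x * F x =
        ∑ s : a × b, F ((eA.symm (s.1, p.1), s.1), (eB.symm (s.2, p.2), s.2)) := by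
    intro p F
    simp only [Fintype.sum_prod_type (α₁ := Fin k × a), Matrix.kroneckerMap_apply, mul_assoc,
      ← Finset.mul_sum, sum_contraction_mul]
    rw [Fintype.sum_prod_type]
  have hstar : ∀ (p : Fin d × Fin d) (x : (Fin k × a) × (Fin l × b)),
      star ((contraction eA ⊗ₖ contraction eB) p x) = (contraction eA ⊗ₖ contraction eB) p x := by
    intro p x
    rw [Matrix.kroneckerMap_apply, star_mul', star_contraction, star_contraction]
  rw [Matrix.mul_assoc, Matrix.mul_apply, hsum]
  refine Finset.sum_congr rfl fun s _ => ?_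
  simp only [Matrix.mul_apply, Matrix.conjTranspose_apply, hstar]
  simp only [mul_comm _ ((contraction eA ⊗ₖ contraction eB) q _), hsum]
  refine Finset.sum_congr rfl fun t _ => ?_
  simp [joint]

/-- The bilinear pairing `tr(V πᵀ)` of a witness with a state. The transpose
comes from the contraction of equal indices in `contraction_joint`. -/
def pairing (V π : Op (a × b)) : ℂ := ∑ s, ∑ t, V s t * π s t

lemma contraction_joint_witnessOp (eA : Fin k ≃ a × Fin d) (eB : Fin l ≃ b × Fin d) (κ : ℝ)
    (V π : Op (a × b)) :
    (contraction eA ⊗ₖ contraction eB) *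
      joint ((witnessOp d κ V).submatrix (Prod.map eA eB) (Prod.map eA eB)) π *
      (contraction eA ⊗ₖ contraction eB)ᴴ =
      (κ * π.trace + pairing V π) • (1 : Op (Fin d × Fin d)) +
        (κ * π.trace - pairing V π) • unnormEnt d := by
  have htr : ∑ s, ∑ t, (1 : Op (a × b)) s t * π s t = π.trace := by
    simp [Matrix.one_apply, Matrix.trace]
  ext p q
  rw [contraction_joint, ← htr]
  simp only [witnessOp, joint, Matrix.add_apply, Matrix.smul_apply, Matrix.submatrix_apply,
    Matrix.kroneckerMap_apply, Matrix.sub_apply, smul_eq_mul, Equiv.prodProdProdComm_apply,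
    pairing, Finset.mul_sum, Finset.sum_mul, ← Finset.sum_add_distrib, ← Finset.sum_sub_distrib]
  refine Finset.sum_congr rfl fun s _ => Finset.sum_congr rfl fun t _ => ?_
  ring

/-- An LOCC protocol which uses the resource `N • witnessOp d κ V` and has fidelity deficit
proportional to the pairing of `V` with the other state. -/
theorem exists_isLOCC_fClass_sub [Nonempty a] [Nonempty b] (hd : 2 ≤ d)
    (eA : Fin k ≃ a × Fin d) (eB : Fin l ≃ b × Fin d) (κ : ℝ) {N : ℝ} (hN : 0 < N)
    (V : Op (a × b)) (hρ : IsState ((N : ℂ) •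
      (witnessOp d κ V).submatrix (Prod.map eA eB) (Prod.map eA eB))) :
    ∃ (Λ : Op ((Fin k × a) × (Fin l × b)) → Op (Fin d × Fin d)) (c : ℝ), IsLOCC Λ ∧ 0 < c ∧
      ∀ π : Op (a × b), IsState π → fClass d - teleportFidelity d (joint ((N : ℂ) •
        (witnessOp d κ V).submatrix (Prod.map eA eB) (Prod.map eA eB)) π) Λ =
          c * (pairing V π).re := by
  have hnorm : ∀ (n : ℕ), 0 < n →
      ((((Real.sqrt n)⁻¹ : ℝ) : ℂ) * ((Real.sqrt n)⁻¹ : ℝ)) * n = 1 := by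
    intro n hn
    have : (0 : ℝ) < n := by exact_mod_cast hn
    rw [← Complex.ofReal_mul, ← mul_inv, Real.mul_self_sqrt this.le, ← Complex.ofReal_natCast,
      ← Complex.ofReal_mul, inv_mul_cancel₀ this.ne', Complex.ofReal_one]
  set r : ℝ := (Real.sqrt (Fintype.card a))⁻¹ with hr
  set s : ℝ := (Real.sqrt (Fintype.card b))⁻¹ with hs
  have hr0 : 0 < r := inv_pos.2 (Real.sqrt_pos.2 (by exact_mod_cast Fintype.card_pos))
  have hs0 : 0 < s := inv_pos.2 (Real.sqrt_pos.2 (by exact_mod_cast Fintype.card_pos))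
  have hS : ((r : ℂ) • contraction eA) * ((r : ℂ) • contraction eA)ᴴ = 1 := by
    rw [Matrix.conjTranspose_smul, Matrix.smul_mul, Matrix.mul_smul, smul_smul,
      contraction_mul_conjTranspose, smul_smul, Complex.star_def, Complex.conj_ofReal,
      hnorm _ Fintype.card_pos, one_smul]
  have hT : ((s : ℂ) • contraction eB) * ((s : ℂ) • contraction eB)ᴴ = 1 := by
    rw [Matrix.conjTranspose_smul, Matrix.smul_mul, Matrix.mul_smul, smul_smul,
      contraction_mul_conjTranspose, smul_smul, Complex.star_def, Complex.conj_ofReal,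
      hnorm _ Fintype.card_pos, one_smul]
  have hd0 : 0 < d := by omega
  obtain ⟨Λ, hΛ, hΛe⟩ := exists_isLOCC_project hS hT (⟨0, hd0⟩ : Fin d) (⟨0, hd0⟩ : Fin d)
  set ρ := (N : ℂ) • (witnessOp d κ V).submatrix (Prod.map eA eB) (Prod.map eA eB) with hρe
  set w : ℝ := r * r * (s * s) * N with hw
  have hw0 : 0 < w := by positivity
  have hdr : (2 : ℝ) ≤ d := by exact_mod_cast hd
  refine ⟨Λ, 2 * w * (d * (d - 1)) / (d + 1), hΛ,
    div_pos (mul_pos (by positivity) (mul_pos (by linarith) (by linarith))) (by positivity),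
    fun π hπ => ?_⟩
  have hjt : (joint ρ π).trace = 1 := by
    rw [trace_joint, hρ.2, hπ.2, one_mul]
  have hj : joint ρ π = (N : ℂ) •
      joint ((witnessOp d κ V).submatrix (Prod.map eA eB) (Prod.map eA eB)) π := by
    ext x y
    simp [joint, hρe, mul_assoc]
  have hY : (((r : ℂ) • contraction eA) ⊗ₖ ((s : ℂ) • contraction eB)) * joint ρ π *
      (((r : ℂ) • contraction eA) ⊗ₖ ((s : ℂ) • contraction eB))ᴴ = (w : ℂ) •
        ((κ + pairing V π) • (1 : Op (Fin d × Fin d)) + (κ - pairing V π) • unnormEnt d) := by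
    have := contraction_joint_witnessOp eA eB κ V π
    rw [hπ.2, mul_one] at this
    rw [← this, hj, Matrix.smul_kronecker, Matrix.kronecker_smul]
    simp only [Matrix.conjTranspose_smul, Matrix.smul_mul, Matrix.mul_smul, smul_smul,
      Complex.star_def, map_mul, Complex.conj_ofReal]
    congr 1
    rw [hw]
    push_cast
    ring
  have hsu : (Matrix.single ((⟨0, hd0⟩ : Fin d), (⟨0, hd0⟩ : Fin d))
      ((⟨0, hd0⟩ : Fin d), (⟨0, hd0⟩ : Fin d)) (1 : ℂ) * unnormEnt d).trace = 1 := by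
    rw [Matrix.trace_single_mul]
    simp [unnormEnt]
  rw [teleportFidelity_eq hd, hΛe, hY, hjt, Matrix.add_mul, Matrix.trace_add,
    Matrix.smul_mul _ (Matrix.single _ _ _), Matrix.trace_smul, hsu]
  simp only [Matrix.smul_mul, Matrix.add_mul, Matrix.one_mul, unnormEnt_mul_self,
    Matrix.trace_smul, Matrix.trace_add, trace_unnormEnt, Matrix.trace_one, Fintype.card_prod,
    Fintype.card_fin, smul_eq_mul]
  set v := pairing V π
  have h : (w * ((κ + v) * d + (κ - v) * (d * d)) +
      (1 - w * ((κ + v) * ((d * d : ℕ) : ℂ) + (κ - v) * d)) * 1) =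
        1 - ((2 * w * (d * (d - 1)) : ℝ) : ℂ) * v := by
    push_cast
    ring
  rw [h, Complex.sub_re, Complex.re_ofReal_mul, Complex.one_re, fClass]
  field_simp
  ring

end

/-! ### Compactness of the set of separable states -/

/-- In finite dimension the convex hull of a compact set is compact: by Carathéodory's theorem it
is the image of a compact set of weights and points, in a bounded number. -/
theorem isCompact_convexHull_of_finiteDimensional {E : Type*} [AddCommGroup E] [Module ℝ E]
    [TopologicalSpace E] [ContinuousAdd E] [ContinuousSMul ℝ E] [FiniteDimensional ℝ E]
    {s : Set E} (hs : IsCompact s) : IsCompact (convexHull ℝ s) := by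
  set n := Module.finrank ℝ E + 1 with hn
  have h : convexHull ℝ s = (fun p : (Fin n → ℝ) × (Fin n → E) => ∑ i, p.1 i • p.2 i) ''
      (stdSimplex ℝ (Fin n) ×ˢ Set.univ.pi fun _ => s) := by
    refine Set.Subset.antisymm (fun x hx => ?_) ?_
    · obtain ⟨ι, hι, z, w, hz, hind, hw, hw1, rfl⟩ := eq_pos_convex_span_of_mem_convexHull hx
      have hne : Nonempty ι := by
        by_contra hne
        rw [not_nonempty_iff] at hne
        simp at hw1
      obtain ⟨i₀⟩ := hne
      have hcard : Fintype.card ι ≤ Fintype.card (Fin n) := by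
        rw [Fintype.card_fin]
        exact hind.card_le_finrank_succ.trans
          (Nat.succ_le_succ (Submodule.finrank_le _))
      obtain ⟨f⟩ := Function.Embedding.nonempty_of_card_le hcard
      have hf := f.injective
      refine ⟨(Function.extend f w 0, Function.extend f z fun _ => z i₀), ⟨⟨fun j => ?_, ?_⟩,
        fun j _ => ?_⟩, ?_⟩
      · by_cases hj : ∃ i, f i = j
        · obtain ⟨i, rfl⟩ := hj
          simpa [hf.extend_apply] using (hw i).le
        · simp [Function.extend_apply' _ _ _ hj]
      · rw [← hw1]
        refine (Fintype.sum_of_injective f hf _ _ (fun j hj => ?_) fun i => ?_).symm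
        · simp [Function.extend_apply' _ _ _ hj]
        · simp [hf.extend_apply]
      · by_cases hj : ∃ i, f i = j
        · obtain ⟨i, rfl⟩ := hj
          simpa [hf.extend_apply] using hz ⟨i, rfl⟩
        · simpa [Function.extend_apply' _ _ _ hj] using hz ⟨i₀, rfl⟩
      · refine (Fintype.sum_of_injective f hf _ _ (fun j hj => ?_) fun i => ?_).symm
        · simp [Function.extend_apply' _ _ _ hj]
        · simp [hf.extend_apply]
    · rintro _ ⟨⟨w, z⟩, ⟨hw, hz⟩, rfl⟩
      exact (convex_convexHull ℝ s).sum_mem (fun i _ => hw.1 i) hw.2 fun i _ =>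
        subset_convexHull ℝ s (hz i trivial)
  rw [h]
  refine ((isCompact_stdSimplex ℝ (Fin n)).prod (isCompact_univ_pi fun _ => hs)).image ?_
  fun_prop

lemma isCompact_setOf_isState (A : Type) [Fintype A] : IsCompact {α : Op A | IsState α} := by
  classical
  have h : {α : Op A | IsState α} = (fun B : Op A => B * Bᴴ) ''
      {B | ∑ i, ∑ j, ‖B i j‖ ^ 2 = 1} := by
    have htr : ∀ B : Op A, (B * Bᴴ).trace = ((∑ i, ∑ j, ‖B i j‖ ^ 2 : ℝ) : ℂ) := fun B => by
      simp only [Matrix.trace, Matrix.diag, Matrix.mul_apply, Matrix.conjTranspose_apply,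
        Complex.star_def, Complex.mul_conj, Complex.normSq_eq_norm_sq]
      push_cast
      rfl
    ext α
    constructor
    · rintro ⟨h1, h2⟩
      obtain ⟨B, rfl⟩ := exists_eq_mul_conjTranspose h1
      rw [htr] at h2
      exact ⟨B, by exact_mod_cast h2, rfl⟩
    · rintro ⟨B, hB, rfl⟩
      refine ⟨Matrix.posSemidef_self_mul_conjTranspose B, ?_⟩
      rw [Set.mem_ofPred_eq] at hB
      rw [htr, hB, Complex.ofReal_one]
  rw [h]
  have hK : IsCompact (Set.univ.pi fun _ : A => Set.univ.pi fun _ : A =>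
      Metric.closedBall (0 : ℂ) 1) :=
    isCompact_univ_pi fun _ => isCompact_univ_pi fun _ => isCompact_closedBall _ _
  have hcl : IsClosed {B : Op A | ∑ i, ∑ j, ‖B i j‖ ^ 2 = 1} :=
    isClosed_eq (by fun_prop) continuous_const
  refine IsCompact.image (IsCompact.of_isClosed_subset hK hcl fun B hB i _ j _ => ?_) (by fun_prop)
  rw [mem_closedBall_zero_iff]
  have h1 : ‖B i j‖ ^ 2 ≤ ∑ j, ‖B i j‖ ^ 2 :=
    Finset.single_le_sum (f := fun j => ‖B i j‖ ^ 2) (fun _ _ => by positivity) (Finset.mem_univ j)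
  have h2 : ∑ j, ‖B i j‖ ^ 2 ≤ ∑ i, ∑ j, ‖B i j‖ ^ 2 :=
    Finset.single_le_sum (f := fun i => ∑ j, ‖B i j‖ ^ 2) (fun _ _ => by positivity)
      (Finset.mem_univ i)
  rw [Set.mem_ofPred_eq] at hB
  rw [hB] at h2
  exact (sq_le_one_iff₀ (norm_nonneg _)).1 (h1.trans h2)

lemma isCompact_sep (A B : Type) [Fintype A] [Fintype B] : IsCompact (Sep A B) := by
  refine isCompact_convexHull_of_finiteDimensional ?_
  have h : {τ : Op (A × B) | ∃ (α : Op A) (β : Op B), IsState α ∧ IsState β ∧ τ = α ⊗ₖ β} =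
      (fun p : Op A × Op B => p.1 ⊗ₖ p.2) '' ({α | IsState α} ×ˢ {β | IsState β}) := by
    ext τ
    constructor
    · rintro ⟨α, β, hα, hβ, rfl⟩
      exact ⟨(α, β), ⟨hα, hβ⟩, rfl⟩
    · rintro ⟨⟨α, β⟩, ⟨hα, hβ⟩, rfl⟩
      exact ⟨α, β, hα, hβ, rfl⟩
  rw [h]
  refine ((isCompact_setOf_isState A).prod (isCompact_setOf_isState B)).image ?_
  refine continuous_matrix fun i j => ?_
  simp only [Matrix.kroneckerMap_apply]
  fun_prop

lemma sep_nonempty (A B : Type) [Fintype A] [Fintype B] [Nonempty A] [Nonempty B] :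
    (Sep A B).Nonempty := by
  classical
  have h : ∀ (A : Type) [Fintype A] [Nonempty A], ∃ α : Op A, IsState α := by
    intro A _ ⟨i⟩
    classical
    refine ⟨Matrix.single i i 1, ?_, Matrix.trace_single_eq_same i 1⟩
    have := Matrix.posSemidef_self_mul_conjTranspose (Matrix.single i i (1 : ℂ))
    rwa [Matrix.conjTranspose_single, Matrix.single_mul_single_same, star_one, mul_one] at this
  obtain ⟨α, hα⟩ := h A
  obtain ⟨β, hβ⟩ := h B
  exact ⟨_, subset_convexHull ℝ _ ⟨α, β, hα, hβ, rfl⟩⟩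

/-! ### Entanglement witnesses for the robustness -/

section
variable {a b : Type} [Fintype a] [DecidableEq a] [Fintype b] [DecidableEq b]

/-- A real linear functional and the trace are represented on Hermitian operators by a Hermitian
operator. -/
lemma exists_pairing_eq (f : Op (a × b) →ₗ[ℝ] ℝ) (t : ℝ) : ∃ V : Op (a × b), V.IsHermitian ∧
    ∀ X : Op (a × b), X.IsHermitian → (pairing V X).re = f X - t * X.trace.re := by
  -- `f X` is the real part of the pairing of `X` with `G`; for Hermitian `X` one may replace `G` by
  -- its Hermitian part.
  set G : Op (a × b) := Matrix.of fun p q =>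
    ⟨f (Matrix.single p q 1), -f (Matrix.single p q Complex.I)⟩ with hG
  have hf : ∀ X, f X = (∑ p, ∑ q, G p q * X p q).re := by
    intro X
    conv_lhs => rw [Matrix.matrix_eq_sum_single X]
    simp only [map_sum, Complex.re_sum]
    refine Finset.sum_congr rfl fun p _ => Finset.sum_congr rfl fun q _ => ?_
    have : Matrix.single p q (X p q) = (X p q).re • Matrix.single p q (1 : ℂ) +
        (X p q).im • Matrix.single p q Complex.I := by
      rw [Matrix.smul_single, Matrix.smul_single, ← Matrix.single_add]
      congr 1
      apply Complex.ext <;> simp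
    rw [this, map_add, map_smul, map_smul]
    simp [hG, Complex.mul_re]
    ring
  refine ⟨(1 / 2 : ℂ) • (G + Gᴴ) - (t : ℂ) • 1, ?_, fun X hX => ?_⟩
  · rw [Matrix.IsHermitian]
    simp [Matrix.conjTranspose_sub, Matrix.conjTranspose_smul, Matrix.conjTranspose_add, add_comm]
  · have h1 : pairing (1 : Op (a × b)) X = X.trace := by
      simp [pairing, Matrix.one_apply, Matrix.trace]
    have h2 : (pairing Gᴴ X).re = (pairing G X).re := by
      rw [pairing, Finset.sum_comm, pairing, ← Complex.conj_re, map_sum]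
      simp only [map_sum, map_mul]
      congr 1
      refine Finset.sum_congr rfl fun p _ => Finset.sum_congr rfl fun q _ => ?_
      rw [Matrix.conjTranspose_apply, ← hX.apply q p]
      simp
    have h3 : pairing ((1 / 2 : ℂ) • (G + Gᴴ) - (t : ℂ) • 1) X =
        ((1 / 2 : ℝ) : ℂ) * (pairing G X + pairing Gᴴ X) - (t : ℂ) * pairing 1 X := by
      simp only [pairing, Finset.mul_sum, ← Finset.sum_add_distrib, ← Finset.sum_sub_distrib]
      refine Finset.sum_congr rfl fun p _ => Finset.sum_congr rfl fun q _ => ?_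
      simp
      ring
    rw [h3, h1, Complex.sub_re, Complex.re_ofReal_mul, Complex.re_ofReal_mul, Complex.add_re, h2,
      hf X, pairing]
    ring

/-- If `σ` is not in `(1 + c) 𝒮 - c 𝒮`, a hyperplane separating it from this compact convex set
gives a witness whose value at `-σ` exceeds `c` times its values at separable states. -/
theorem exists_witness [Nonempty a] [Nonempty b] {σ : Op (a × b)} (hσ : IsState σ) {c : ℝ}
    (hc : 0 ≤ c) (h : ∀ π ∈ Sep a b, (1 / (1 + c)) • σ + (c / (1 + c)) • π ∉ Sep a b) :
    ∃ V : Op (a × b), V.IsHermitian ∧ ∃ ε > 0, (∀ π ∈ Sep a b, ε ≤ (pairing V π).re) ∧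
      ∀ π ∈ Sep a b, (pairing V σ).re + c * (pairing V π).re < 0 := by
  have : LocallyConvexSpace ℝ (Op (a × b)) :=
    inferInstanceAs (LocallyConvexSpace ℝ (a × b → a × b → ℂ))
  have hc1 : 0 < 1 + c := by linarith
  set F : Op (a × b) × Op (a × b) →ₗ[ℝ] Op (a × b) :=
    (1 + c) • LinearMap.fst ℝ _ _ - c • LinearMap.snd ℝ _ _ with hF
  have hFa : ∀ x y, F (x, y) = (1 + c) • x - c • y := fun x y => rfl
  have hconv : Convex ℝ (F '' (Sep a b ×ˢ Sep a b)) :=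
    ((convex_convexHull ℝ _).prod (convex_convexHull ℝ _)).linear_image F
  have hcomp : IsCompact (F '' (Sep a b ×ˢ Sep a b)) := by
    refine ((isCompact_sep a b).prod (isCompact_sep a b)).image ?_
    have : (F : Op (a × b) × Op (a × b) → Op (a × b)) = fun p => (1 + c) • p.1 - c • p.2 := rfl
    rw [this]
    fun_prop
  have hσD : σ ∉ F '' (Sep a b ×ˢ Sep a b) := by
    rintro ⟨⟨x, y⟩, ⟨hx, hy⟩, rfl⟩
    refine h y hy ?_
    have : (1 / (1 + c)) • F (x, y) + (c / (1 + c)) • y = x := by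
      rw [hFa, smul_sub, smul_smul, smul_smul, one_div_mul_cancel hc1.ne', one_smul,
        one_div_mul_eq_div, sub_add_cancel]
    rw [this]
    exact hx
  obtain ⟨f, u, hfσ, hfu⟩ := geometric_hahn_banach_point_closed hconv hcomp.isClosed hσD
  have hfF : ∀ x ∈ Sep a b, ∀ y ∈ Sep a b, u < (1 + c) * f x - c * f y := by
    intro x hx y hy
    have := hfu _ ⟨(x, y), ⟨hx, hy⟩, rfl⟩
    rwa [hFa, map_sub, map_smul, map_smul] at this
  obtain ⟨x₀, hx₀, hmin⟩ := (isCompact_sep a b).exists_isMinOn (sep_nonempty a b)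
    f.continuous.continuousOn
  -- On states, subtracting the multiple `f x₀ - δ` of the trace makes `f` at least `δ` on separable
  -- states and costs half of the gap between `f σ` and `u`.
  set δ : ℝ := (u - f σ) / (2 * (1 + c)) with hδ
  have hδ0 : 0 < δ := div_pos (by linarith) (by linarith)
  obtain ⟨V, hV, hVf⟩ := exists_pairing_eq (f : Op (a × b) →ₗ[ℝ] ℝ) (f x₀ - δ)
  have hVs : ∀ {X : Op (a × b)}, IsState X → (pairing V X).re = f X - f x₀ + δ := by
    intro X hX
    rw [hVf X hX.1.1, hX.2, Complex.one_re]
    change f X - _ = _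
    ring
  refine ⟨V, hV, δ, hδ0, fun π hπ => ?_, fun π hπ => ?_⟩
  · rw [hVs (isState_of_mem_sep hπ)]
    have : f x₀ ≤ f π := hmin hπ
    linarith
  · rw [hVs hσ, hVs (isState_of_mem_sep hπ)]
    have h1 := hfF x₀ hx₀ π hπ
    have h2 : 2 * (1 + c) * δ = u - f σ := by
      rw [hδ]
      field_simp
    linarith

end

/-! ### The lower bound -/

lemma trace_pureState {a : Type} [Fintype a] (u : a → ℂ) :
    (pureState u).trace = ((∑ x, ‖u x‖ ^ 2 : ℝ) : ℂ) := by
  simp only [pureState, Matrix.trace, Matrix.diag, Matrix.vecMulVec_apply, Pi.star_apply,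
    Complex.star_def, Complex.mul_conj, Complex.normSq_eq_norm_sq]
  push_cast
  rfl

lemma isState_smul_pureState {a : Type} [Fintype a] [DecidableEq a] {u : a → ℂ}
    (hu : 0 < ∑ x, ‖u x‖ ^ 2) :
    IsState ((((∑ x, ‖u x‖ ^ 2)⁻¹ : ℝ) : ℂ) • pureState u) := by
  refine ⟨(Matrix.posSemidef_vecMulVec_self_star u).smul
    (by exact_mod_cast (inv_pos.2 hu).le), ?_⟩
  rw [Matrix.trace_smul, trace_pureState, smul_eq_mul, ← Complex.ofReal_mul,
    inv_mul_cancel₀ hu.ne', Complex.ofReal_one]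

section
variable {a b : Type} [Fintype a] [DecidableEq a] [Fintype b] [DecidableEq b]

/-- A lower bound for a witness on separable states bounds its partially transposed form on
product vectors, since `|v⟩⟨v|` and its transpose are both pure states. -/
lemma le_re_ptForm {V : Op (a × b)} {ε : ℝ} (hV : ∀ π ∈ Sep a b, ε ≤ (pairing V π).re)
    (u : a → ℂ) (v : b → ℂ) : ε * ((∑ x, ‖u x‖ ^ 2) * ∑ y, ‖v y‖ ^ 2) ≤
      (ptForm V (fun x y => u x * v y) fun x y => u x * v y).re := by
  have hzero : ∀ {c : Type} [Fintype c] (w : c → ℂ), ¬ 0 < ∑ x, ‖w x‖ ^ 2 → ∀ x, w x = 0 := by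
    intro c _ w hw x
    have h0 : ∑ x, ‖w x‖ ^ 2 = 0 :=
      le_antisymm (not_lt.1 hw) (Finset.sum_nonneg fun _ _ => by positivity)
    have := (Finset.sum_eq_zero_iff_of_nonneg (fun _ _ => by positivity)).1 h0 x (Finset.mem_univ x)
    simpa using this
  by_cases hu : 0 < ∑ x, ‖u x‖ ^ 2
  swap
  · simp [hzero u hu, ptForm]
  by_cases hv : 0 < ∑ y, ‖v y‖ ^ 2
  swap
  · simp [hzero v hv, ptForm]
  have hv' : ∑ y, ‖(star v) y‖ ^ 2 = ∑ y, ‖v y‖ ^ 2 := by simp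
  have hβ := isState_smul_pureState (u := star v) (by rwa [hv'])
  rw [hv'] at hβ
  have h := hV _ (subset_convexHull ℝ _ ⟨_, _, isState_smul_pureState hu, hβ, rfl⟩)
  set p := ∑ x, ‖u x‖ ^ 2
  set q := ∑ y, ‖v y‖ ^ 2
  have he : pairing V ((((p⁻¹ : ℝ) : ℂ) • pureState u) ⊗ₖ (((q⁻¹ : ℝ) : ℂ) • pureState (star v))) =
      ((p⁻¹ * q⁻¹ : ℝ) : ℂ) * ptForm V (fun x y => u x * v y) fun x y => u x * v y := by
    simp only [pairing, ptForm, Finset.mul_sum]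
    refine Finset.sum_congr rfl fun s _ => Finset.sum_congr rfl fun t _ => ?_
    simp only [Matrix.kroneckerMap_apply, Matrix.smul_apply, pureState, Matrix.vecMulVec_apply,
      smul_eq_mul, Pi.star_apply, star_star, star_mul']
    push_cast
    ring
  rw [he, Complex.re_ofReal_mul] at h
  have := mul_le_mul_of_nonneg_left h (mul_pos hu hv).le
  calc ε * (p * q) = p * q * ε := mul_comm _ _
    _ ≤ _ := this
    _ = _ := by field_simp

end

section
variable {m n d : ℕ} {σ : Op (Fin m × Fin n)}

/-- If no mixture of `σ` and a separable state with weights `1 : c` is separable, a witness provides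
a useless state which `σ` activates with ratio at least `c`. -/
theorem le_activationCapacity [Nonempty (Fin m)] [Nonempty (Fin n)] (hd : 2 ≤ d) (hσ : IsState σ)
    {c : ℝ} (hc : 0 ≤ c)
    (h : ∀ π ∈ Sep (Fin m) (Fin n), (1 / (1 + c)) • σ + (c / (1 + c)) • π ∉ Sep (Fin m) (Fin n)) :
    (c : EReal) ≤ activationCapacity d σ := by
  obtain ⟨V, hVh, ε, hε, hVε, hVσ⟩ := exists_witness hσ hc h
  have hd0 : 0 < d := by omega
  obtain ⟨κ, N, hN, hρ⟩ := exists_useless_witnessOp hd0 hVh hε (le_re_ptForm hVε)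
    (finProdFinEquiv (m := m) (n := d)).symm (finProdFinEquiv (m := n) (n := d)).symm
  obtain ⟨Λ, w, hΛ, hw, hΛw⟩ := exists_isLOCC_fClass_sub hd _ _ κ hN V hρ.1
  set ρ := (N : ℂ) • (witnessOp d κ V).submatrix
    (Prod.map (finProdFinEquiv (m := m) (n := d)).symm (finProdFinEquiv (m := n) (n := d)).symm)
    (Prod.map (finProdFinEquiv (m := m) (n := d)).symm (finProdFinEquiv (m := n) (n := d)).symm)
  obtain ⟨π₀, hπ₀⟩ := sep_nonempty (Fin m) (Fin n)
  have hpos : 0 < spread d ρ Λ := by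
    have h1 := le_csSup (bddAbove_spread (A' := Fin m) (B' := Fin n) hd hρ.1 hΛ) ⟨π₀, hπ₀, rfl⟩
    rw [hΛw π₀ (isState_of_mem_sep hπ₀)] at h1
    exact (mul_pos hw (hε.trans_le (hVε π₀ hπ₀))).trans_le h1
  refine le_trans ?_ (le_sSup ⟨m * d, n * d, ρ, Λ, hρ, hΛ, hpos.ne', rfl⟩)
  rw [EReal.coe_le_coe_iff, le_div_iff₀ hpos]
  have h2 := hΛw σ hσ
  have h3 : teleportFidelity d (joint ρ σ) Λ - fClass d = -(w * (pairing V σ).re) := by linarith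
  rw [h3]
  have h4 : ∀ π ∈ Sep (Fin m) (Fin n),
      c * (fClass d - teleportFidelity d (joint ρ π) Λ) ≤ -(w * (pairing V σ).re) := by
    intro π hπ
    rw [hΛw π (isState_of_mem_sep hπ)]
    nlinarith [mul_pos hw (neg_pos.2 (hVσ π hπ))]
  rcases hc.eq_or_lt with rfl | hc0
  · simpa using h4 π₀ hπ₀
  · rw [← le_div_iff₀' hc0]
    refine csSup_le ⟨_, π₀, hπ₀, rfl⟩ ?_
    rintro _ ⟨π, hπ, rfl⟩
    rw [le_div_iff₀' hc0]
    exact h4 π hπ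

/-- Every real `c` with `0 ≤ c < R(σ)` satisfies the hypothesis of `le_activationCapacity`. -/
theorem robustness_le_activationCapacity [Nonempty (Fin m)] [Nonempty (Fin n)] (hd : 2 ≤ d)
    (hσ : IsState σ) (hent : σ ∉ Sep (Fin m) (Fin n)) : robustness σ ≤ activationCapacity d σ := by
  -- The case `c = 0` uses that `σ` is entangled; it rules out negative real bounds below.
  have h0 : ((0 : ℝ) : EReal) ≤ activationCapacity d σ :=
    le_activationCapacity hd hσ le_rfl fun π _ => by simpa using hent
  refine EReal.le_of_forall_lt_iff_le.1 fun c hc => ?_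
  by_contra hlt
  have hc0 : 0 ≤ c := (EReal.coe_lt_coe_iff.1 (h0.trans_lt hc)).le
  refine hc.not_ge (le_activationCapacity hd hσ hc0 fun π hπ hmem => hlt ?_)
  exact (iInf₂_le π hπ).trans ((iInf_le _ c).trans (iInf₂_le hc0 hmem))

end
end Activation

theorem theorem1 (d : ℕ) (hd : 2 ≤ d) (m n : ℕ)
    (σ : Matrix (Fin m × Fin n) (Fin m × Fin n) ℂ)
    (hσ : Activation.IsState σ) (hent : σ ∉ Activation.Sep (Fin m) (Fin n)) :
    Activation.activationCapacity d σ = Activation.robustness σ := by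
  have hne : Nonempty (Fin m × Fin n) := by
    by_contra hne
    rw [not_nonempty_iff] at hne
    have := hσ.2
    simp [Matrix.trace] at this
  have hm : Nonempty (Fin m) := hne.map Prod.fst
  have hn : Nonempty (Fin n) := hne.map Prod.snd
  exact le_antisymm (Activation.activationCapacity_le_robustness hd σ)
    (Activation.robustness_le_activationCapacity hd hσ hent)
end
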